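/- Let $M$ be a complex manifold of complex dimension $n>1$ with complex structure $J$, and let $g$ be an indefinite Hermitian metric on $M$ of index $\nu$, $0<\nu<2n$, with Levi-Civita connection $\nabla$. Assume that $(M,J,g)$ is locally conformal Kähler with Lee form $\omega$: each point has an open neighbourhood $U$ and a smooth $f:U\to\mathbb R$ such that $e^{-f}g$ is an indefinite Kähler metric on $U$ (i.e. $J$ is parallel for its Levi-Civita connection) and $\omega=df$ on $U$. Assume that $\nabla\omega=0$. Let $B$ be the Lee field, $g(X,B)=\omega(X)$, let $A=-JB$ be the anti-Lee field, and let $\mathrm{Sing}(B)=\{x: B_x=0\}$. Then the function $g(B,B)$ is locally constant. Assume moreover that it is a constant $c\in\mathbb R$ (which is automatic if $M$ is connected). Put $M(c)=M\setminus\mathrm{Sing}(B)$, which is open in $M$. On $M(c)$ the sum $P_x=\mathbb RA_x\oplus\mathbb RB_x\subset T_xM$ is direct, $P$ is a smooth involutive distribution of rank $2$, and it is integrable: every point of $M(c)$ lies in the domain, contained in $M(c)$, of a smooth chart of $M$ in which $P$ becomes a fixed $2$-plane of the model space. Hence $P$ is tangent to a foliation $\mathcal F_c$ of $M(c)$ by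 real surfaces. Moreover, for every smoothly immersed surface $i:L\to M(c)$ with $di(T_pL)=P_{i(p)}$ for all $p\in L$, in particular for every leaf $L$ of $\mathcal F_c$: (i) if $c\neq 0$, then $\mathrm{Sing}(B)=\emptyset$, the metric $\mathrm{sign}(c)\,i^*g$ on $L$ is Riemannian, the second fundamental form of $L$ in $(M,g)$ (the normal part of $\nabla$) vanishes, and $L$ is totally geodesic: each geodesic of the induced connection of $L$ is a geodesic of $(M,g)$; (ii) if $c=0$ and $n\ge 3$, then $L$ is isotropic, i.e. $T(L)\cap T(L)^\perp$ has rank $\dim L$ and $\dim L<\operatorname{codim}L$; if $c=0$ and $n=2$, then $L$ is totally lightlike, i.e. $T(L)\cap T(L)^\perp$ has rank $\dim L=\operatorname{codim}L$; (iii) if $c=0$ and $n\ge 3$, let $S$ be any smooth complement of $T(L)$ in $T(L)^\perp$ and $\mathrm{ltr}$ any smooth totally null complement of $T(L)$ in $S^\perp$. Then the transversal vector bundle $\mathrm{tr}(T(L))=\mathrm{ltr}\oplus S$ is a complement of $T(L)$ in $i^*TM$, and the second fundamental form of $L$ with respect to it (the $\mathrm{tr}(T(L))$-component of $\nabla_XY$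 for $X,Y$ tangent to $L$) vanishes. -/

import Mathlib

open scoped Manifold ContDiff Topology

noncomputable section

namespace LCK

/-! ### Complex manifolds and their real tangent bundle

A complex `n`-manifold `M` is charted on a complex normed space `E` of complex dimension `n`, with
holomorphic transition maps.  Its real tangent bundle is the one of the model `𝓘(ℝ, E)`. -/

/-- A complex manifold is a real (analytic, hence smooth) manifold. -/
instance isManifold_real {E : Type*} [NormedAddCommGroup E] [NormedSpace ℂ E]
    {M : Type*} [TopologicalSpace M] [ChartedSpace E M] [IsManifold 𝓘(ℂ, E) ω M] :
    IsManifold 𝓘(ℝ, E) ω M := by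
  apply isManifold_of_contDiffOn
  intro e e' he he'
  have h := (contDiffGroupoid ω 𝓘(ℂ, E)).compatible he he'
  rw [contDiffGroupoid, mem_groupoid_of_pregroupoid] at h
  have h' := ContDiffOn.restrict_scalars ℝ h.1
  simpa using h'

section Definitions

variable {E : Type*} [NormedAddCommGroup E] [NormedSpace ℂ E]
  {M : Type*} [TopologicalSpace M] [ChartedSpace E M]

/-- The complex structure `J` on the real tangent space at `x`: multiplication by `i` in the
preferred holomorphic chart at `x` (hence in any holomorphic chart). -/
def complexStructure (x : M) : TangentSpace 𝓘(ℝ, E) x →L[ℝ] TangentSpace 𝓘(ℝ, E) x :=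
  (show E →L[ℝ] E from (Complex.I • ContinuousLinearMap.id ℂ E).restrictScalars ℝ)

/-- A field of bilinear forms `h` on the tangent spaces, as bilinear forms in the algebraic
sense. -/
def form (h : Π x : M, TangentSpace 𝓘(ℝ, E) x →L[ℝ] TangentSpace 𝓘(ℝ, E) x →L[ℝ] ℝ) (x : M) :
    LinearMap.BilinForm ℝ (TangentSpace 𝓘(ℝ, E) x) :=
  LinearMap.mk₂ ℝ (fun v w => h x v w) (by intros; simp) (by intros; simp) (by intros; simp)
    (by intros; simp)

/-- The orthogonal complement of a subspace of a tangent space. -/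
def perp (h : Π x : M, TangentSpace 𝓘(ℝ, E) x →L[ℝ] TangentSpace 𝓘(ℝ, E) x →L[ℝ] ℝ) (x : M)
    (W : Submodule ℝ (TangentSpace 𝓘(ℝ, E) x)) : Submodule ℝ (TangentSpace 𝓘(ℝ, E) x) :=
  (form h x).orthogonal W

/-- `g` is an indefinite Hermitian metric of index `ν`: a smooth field of symmetric nondegenerate
bilinear forms of index `ν` (the maximal dimension of a negative definite subspace), for which the
complex structure is isometric. -/
structure IsHermitianMetric [IsManifold 𝓘(ℂ, E) ω M]
    (g : Π x : M, TangentSpace 𝓘(ℝ, E) x →L[ℝ] TangentSpace 𝓘(ℝ, E) x →L[ℝ] ℝ) (ν : ℕ) :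
    Prop where
  contMDiff : ContMDiff 𝓘(ℝ, E) (𝓘(ℝ, E).prod 𝓘(ℝ, E →L[ℝ] E →L[ℝ] ℝ)) ∞
    (fun x => Bundle.TotalSpace.mk' (E →L[ℝ] E →L[ℝ] ℝ)
      (E := fun x : M => TangentSpace 𝓘(ℝ, E) x →L[ℝ] TangentSpace 𝓘(ℝ, E) x →L[ℝ] ℝ) x (g x))
  symm : ∀ (x : M) (v w : TangentSpace 𝓘(ℝ, E) x), g x v w = g x w v
  nondegenerate : ∀ (x : M) (v : TangentSpace 𝓘(ℝ, E) x), (∀ w, g x v w = 0) → v = 0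
  index : ∀ x : M, sigNeg (form g x).toQuadraticMap = ν
  hermitian : ∀ (x : M) (v w : TangentSpace 𝓘(ℝ, E) x),
    g x (complexStructure x v) (complexStructure x w) = g x v w

/-- The vector field `X` is differentiable at `x`. -/
abbrev IsDiffAt [IsManifold 𝓘(ℂ, E) ω M] (X : Π x : M, TangentSpace 𝓘(ℝ, E) x) (x : M) : Prop :=
  MDifferentiableAt 𝓘(ℝ, E) 𝓘(ℝ, E).tangent (fun y => (⟨y, X y⟩ : TangentBundle 𝓘(ℝ, E) M)) x

/-- `nabla` is the Levi-Civita connection of the metric `h` on the open set `U`: a covariant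
derivative on `U` which is torsion free and for which `h` is parallel.
Here `nabla Y x v` is `∇_v Y` at `x`. -/
structure IsLeviCivitaOn
    (h : Π x : M, TangentSpace 𝓘(ℝ, E) x →L[ℝ] TangentSpace 𝓘(ℝ, E) x →L[ℝ] ℝ)
    (nabla : (Π x : M, TangentSpace 𝓘(ℝ, E) x) →
      (Π x : M, TangentSpace 𝓘(ℝ, E) x →L[ℝ] TangentSpace 𝓘(ℝ, E) x))
    (U : Set M) [IsManifold 𝓘(ℂ, E) ω M] : Prop where
  isCovariantDerivativeOn : IsCovariantDerivativeOn E nabla U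
  torsionFree : ∀ x ∈ U, ∀ X Y : Π x : M, TangentSpace 𝓘(ℝ, E) x,
    IsDiffAt X x → IsDiffAt Y x →
      nabla Y x (X x) - nabla X x (Y x) = VectorField.mlieBracket 𝓘(ℝ, E) X Y x
  metric : ∀ x ∈ U, ∀ X Y : Π x : M, TangentSpace 𝓘(ℝ, E) x,
    IsDiffAt X x → IsDiffAt Y x → ∀ v : TangentSpace 𝓘(ℝ, E) x,
      mvfderiv 𝓘(ℝ, E) (fun y => h y (X y) (Y y)) x v
        = h x (nabla X x v) (Y x) + h x (X x) (nabla Y x v)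

/-- The metric `h` is an indefinite Kähler metric on the open set `U`: the complex structure is
parallel, `∇J = 0`, for the Levi-Civita connection of `h` on `U`. -/
def IsKahlerOn (h : Π x : M, TangentSpace 𝓘(ℝ, E) x →L[ℝ] TangentSpace 𝓘(ℝ, E) x →L[ℝ] ℝ)
    (U : Set M) [IsManifold 𝓘(ℂ, E) ω M] : Prop :=
  ∃ nabla : (Π x : M, TangentSpace 𝓘(ℝ, E) x) →
      (Π x : M, TangentSpace 𝓘(ℝ, E) x →L[ℝ] TangentSpace 𝓘(ℝ, E) x),
    IsLeviCivitaOn h nabla U ∧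
    ∀ x ∈ U, ∀ Y : Π x : M, TangentSpace 𝓘(ℝ, E) x, IsDiffAt Y x →
      ∀ v : TangentSpace 𝓘(ℝ, E) x,
        nabla (fun y => complexStructure y (Y y)) x v = complexStructure x (nabla Y x v)

/-- `g` is locally conformal Kähler with Lee form `lee`: each point has an open neighbourhood `U`
carrying a smooth function `f` such that `e^{-f} g` is an indefinite Kähler metric on `U` and
`lee = df` on `U`. -/
def IsLocallyConformalKahler [IsManifold 𝓘(ℂ, E) ω M]
    (g : Π x : M, TangentSpace 𝓘(ℝ, E) x →L[ℝ] TangentSpace 𝓘(ℝ, E) x →L[ℝ] ℝ)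
    (lee : Π x : M, TangentSpace 𝓘(ℝ, E) x →L[ℝ] ℝ) : Prop :=
  ∀ x : M, ∃ (U : Set M) (f : M → ℝ), IsOpen U ∧ x ∈ U ∧
    ContMDiffOn 𝓘(ℝ, E) 𝓘(ℝ, ℝ) ∞ f U ∧
    IsKahlerOn (fun y => Real.exp (-f y) • g y) U ∧
    ∀ y ∈ U, lee y = mvfderiv 𝓘(ℝ, E) f y

/-- The 1-form `lee` is parallel: `∇ω = 0`. -/
def IsParallelForm
    (nabla : (Π x : M, TangentSpace 𝓘(ℝ, E) x) →
      (Π x : M, TangentSpace 𝓘(ℝ, E) x →L[ℝ] TangentSpace 𝓘(ℝ, E) x))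
    (lee : Π x : M, TangentSpace 𝓘(ℝ, E) x →L[ℝ] ℝ) [IsManifold 𝓘(ℂ, E) ω M] : Prop :=
  ∀ (x : M) (Y : Π x : M, TangentSpace 𝓘(ℝ, E) x), IsDiffAt Y x →
    ∀ v : TangentSpace 𝓘(ℝ, E) x,
      mvfderiv 𝓘(ℝ, E) (fun y => lee y (Y y)) x v = lee x (nabla Y x v)

/-- `B` is the Lee field: `g(X, B) = ω(X)`. -/
def IsLeeField (g : Π x : M, TangentSpace 𝓘(ℝ, E) x →L[ℝ] TangentSpace 𝓘(ℝ, E) x →L[ℝ] ℝ)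
    (lee : Π x : M, TangentSpace 𝓘(ℝ, E) x →L[ℝ] ℝ)
    (B : Π x : M, TangentSpace 𝓘(ℝ, E) x) : Prop :=
  ∀ (x : M) (v : TangentSpace 𝓘(ℝ, E) x), g x v (B x) = lee x v

/-- The anti-Lee field `A = -JB`. -/
def antiLee (B : Π x : M, TangentSpace 𝓘(ℝ, E) x) : Π x : M, TangentSpace 𝓘(ℝ, E) x :=
  fun x => -complexStructure x (B x)

/-- `Sing(B)`, the zero set of `B`. -/
def Sing (B : Π x : M, TangentSpace 𝓘(ℝ, E) x) : Set M := {x | B x = 0}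

/-- `P = ℝA + ℝB`. -/
def leePlane (B : Π x : M, TangentSpace 𝓘(ℝ, E) x) (x : M) :
    Submodule ℝ (TangentSpace 𝓘(ℝ, E) x) :=
  Submodule.span ℝ {antiLee B x, B x}

/-! ### Distributions and foliations -/

/-- `P` is a smooth distribution of rank `k` on the open set `U`: locally on `U` it is spanned by
`k` smooth, pointwise linearly independent vector fields. -/
def IsSmoothDistributionOn [IsManifold 𝓘(ℂ, E) ω M]
    (P : Π x : M, Submodule ℝ (TangentSpace 𝓘(ℝ, E) x)) (k : ℕ) (U : Set M) : Prop :=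
  ∀ x ∈ U, ∃ V ∈ 𝓝 x, ∃ s : Fin k → Π y : M, TangentSpace 𝓘(ℝ, E) y,
    (∀ j, ContMDiffOn 𝓘(ℝ, E) 𝓘(ℝ, E).tangent ∞
      (fun y => (⟨y, s j y⟩ : TangentBundle 𝓘(ℝ, E) M)) V) ∧
    ∀ y ∈ V, LinearIndependent ℝ (fun j => s j y) ∧
      P y = Submodule.span ℝ (Set.range fun j => s j y)

/-- `P` is involutive on `U`: Lie brackets of smooth local sections of `P` are sections of `P`. -/
def IsInvolutiveOn [IsManifold 𝓘(ℂ, E) ω M]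
    (P : Π x : M, Submodule ℝ (TangentSpace 𝓘(ℝ, E) x)) (U : Set M) : Prop :=
  ∀ V : Set M, IsOpen V → V ⊆ U → ∀ X Y : Π x : M, TangentSpace 𝓘(ℝ, E) x,
    ContMDiffOn 𝓘(ℝ, E) 𝓘(ℝ, E).tangent ∞ (fun y => (⟨y, X y⟩ : TangentBundle 𝓘(ℝ, E) M)) V →
    ContMDiffOn 𝓘(ℝ, E) 𝓘(ℝ, E).tangent ∞ (fun y => (⟨y, Y y⟩ : TangentBundle 𝓘(ℝ, E) M)) V →
    (∀ y ∈ V, X y ∈ P y ∧ Y y ∈ P y) →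
    ∀ y ∈ V, VectorField.mlieBracket 𝓘(ℝ, E) X Y y ∈ P y

/-- `P` is the tangent distribution of a smooth foliation of the open set `U` by leaves of
dimension `k`: `U` is covered by smooth charts `φ` of `M` (foliated charts) in which `P` becomes a
fixed `k`-dimensional subspace `F` of the model space, so that the plaques are the sets
`φ⁻¹(a + F)`. -/
def IsTangentToFoliationOn [IsManifold 𝓘(ℂ, E) ω M]
    (P : Π x : M, Submodule ℝ (TangentSpace 𝓘(ℝ, E) x)) (k : ℕ) (U : Set M) : Prop :=
  ∀ x ∈ U, ∃ φ ∈ IsManifold.maximalAtlas 𝓘(ℝ, E) ∞ M, x ∈ φ.source ∧ φ.source ⊆ U ∧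
    ∃ F : Submodule ℝ E, Module.finrank ℝ F = k ∧
      ∀ y ∈ φ.source, ∀ v : TangentSpace 𝓘(ℝ, E) y,
        v ∈ P y ↔ (mfderiv 𝓘(ℝ, E) 𝓘(ℝ, E) φ y v : E) ∈ F

/-! ### Integral surfaces and their second fundamental form -/

section Surfaces

variable {L : Type*} [TopologicalSpace L] [ChartedSpace (EuclideanSpace ℝ (Fin 2)) L]

/-- The tangent plane `di(T_p L)` of a surface `i : L → M`, as a subspace of `T_{i(p)} M`. -/
def tangentPlane (i : L → M) (p : L) : Submodule ℝ (TangentSpace 𝓘(ℝ, E) (i p)) :=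
  LinearMap.range
    (mfderiv 𝓘(ℝ, EuclideanSpace ℝ (Fin 2)) 𝓘(ℝ, E) i p).toLinearMap

/-- `i : L → M` is an integral surface of `P` in `U`: a smooth immersion into `U` of a surface
with `di(T_p L) = P_{i(p)}` for all `p`.  The leaves of the foliation tangent to `P` are the maximal
connected, injectively immersed, integral surfaces. -/
structure IsIntegralSurface [IsManifold 𝓘(ℂ, E) ω M]
    (P : Π x : M, Submodule ℝ (TangentSpace 𝓘(ℝ, E) x)) (U : Set M) (i : L → M) : Prop where
  contMDiff : ContMDiff 𝓘(ℝ, EuclideanSpace ℝ (Fin 2)) 𝓘(ℝ, E) ∞ i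
  mem : ∀ p, i p ∈ U
  immersion : ∀ p,
    Function.Injective (mfderiv 𝓘(ℝ, EuclideanSpace ℝ (Fin 2)) 𝓘(ℝ, E) i p)
  tangent : ∀ p, tangentPlane i p = P (i p)

/-- A field `S` of subspaces of the tangent spaces of `M` along `i : L → M` is a smooth subbundle
of `i^* TM` of rank `k`. -/
def IsSubbundleAlong [IsManifold 𝓘(ℂ, E) ω M] (i : L → M)
    (S : Π p : L, Submodule ℝ (TangentSpace 𝓘(ℝ, E) (i p))) (k : ℕ) : Prop :=
  ∀ p : L, ∃ V ∈ 𝓝 p, ∃ s : Fin k → Π q : L, TangentSpace 𝓘(ℝ, E) (i q),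
    (∀ j, ContMDiffOn 𝓘(ℝ, EuclideanSpace ℝ (Fin 2)) 𝓘(ℝ, E).tangent ∞
      (fun q => (⟨i q, s j q⟩ : TangentBundle 𝓘(ℝ, E) M)) V) ∧
    ∀ q ∈ V, LinearIndependent ℝ (fun j => s j q) ∧
      S q = Submodule.span ℝ (Set.range fun j => s j q)

/-- The normal bundle `T(L)^⊥` along `i : L → M`. -/
def normalBundle (g : Π x : M, TangentSpace 𝓘(ℝ, E) x →L[ℝ] TangentSpace 𝓘(ℝ, E) x →L[ℝ] ℝ)
    (i : L → M) (p : L) : Submodule ℝ (TangentSpace 𝓘(ℝ, E) (i p)) :=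
  perp g (i p) (tangentPlane i p)

/-- The second fundamental form of `i : L → M` with respect to the complement `tr` of the tangent
bundle of `L` in `i^* TM` is defined and vanishes: `i^* TM = T(L) ⊕ tr`, and the `tr`-component
`h(v, Y)` of `∇_{di(v)} Y` is zero for each `v ∈ T_p L` and each smooth local vector field `Y`
tangent to `L`. -/
def SecondFundamentalFormVanishes [IsManifold 𝓘(ℂ, E) ω M]
    (nabla : (Π x : M, TangentSpace 𝓘(ℝ, E) x) →
      (Π x : M, TangentSpace 𝓘(ℝ, E) x →L[ℝ] TangentSpace 𝓘(ℝ, E) x))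
    (i : L → M) (tr : Π p : L, Submodule ℝ (TangentSpace 𝓘(ℝ, E) (i p))) : Prop :=
  ∀ p : L, ∃ hp : IsCompl (tr p) (tangentPlane i p),
    ∀ (v : TangentSpace 𝓘(ℝ, EuclideanSpace ℝ (Fin 2)) p)
      (Y : Π x : M, TangentSpace 𝓘(ℝ, E) x),
      ContMDiffAt 𝓘(ℝ, E) 𝓘(ℝ, E).tangent ∞
        (fun y => (⟨y, Y y⟩ : TangentBundle 𝓘(ℝ, E) M)) (i p) →
      (∀ᶠ q in 𝓝 p, Y (i q) ∈ tangentPlane i q) →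
      (tr p).projection (tangentPlane i p) hp
        (nabla Y (i p) (mfderiv 𝓘(ℝ, EuclideanSpace ℝ (Fin 2)) 𝓘(ℝ, E) i p v)) = 0

/-- `ε i^* g` is a Riemannian metric on `L`. -/
def IsRiemannianUpTo (g : Π x : M, TangentSpace 𝓘(ℝ, E) x →L[ℝ] TangentSpace 𝓘(ℝ, E) x →L[ℝ] ℝ)
    (i : L → M) (ε : ℝ) : Prop :=
  ∀ (p : L) (v : TangentSpace 𝓘(ℝ, EuclideanSpace ℝ (Fin 2)) p), v ≠ 0 →
    0 < ε * g (i p) (mfderiv 𝓘(ℝ, EuclideanSpace ℝ (Fin 2)) 𝓘(ℝ, E) i p v)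
      (mfderiv 𝓘(ℝ, EuclideanSpace ℝ (Fin 2)) 𝓘(ℝ, E) i p v)

/-- The velocity of a curve. -/
def velocity (γ : ℝ → M) (t : ℝ) : TangentSpace 𝓘(ℝ, E) (γ t) :=
  mfderiv 𝓘(ℝ, ℝ) 𝓘(ℝ, E) γ t (1 : ℝ)

/-- The covariant acceleration `∇_{γ'} γ'` of `γ` at the time `t` is `a`, computed from a smooth
local vector field extending the velocity of `γ` near `t`. Such an extension exists when
`γ'(t) ≠ 0` and when `γ` is constant near `t`; since a geodesic with `γ'(t) = 0` is constant, this
suffices for geodesics. -/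
def HasAcceleration [IsManifold 𝓘(ℂ, E) ω M]
    (nabla : (Π x : M, TangentSpace 𝓘(ℝ, E) x) →
      (Π x : M, TangentSpace 𝓘(ℝ, E) x →L[ℝ] TangentSpace 𝓘(ℝ, E) x))
    (γ : ℝ → M) (t : ℝ) (a : TangentSpace 𝓘(ℝ, E) (γ t)) : Prop :=
  ∃ V : Π x : M, TangentSpace 𝓘(ℝ, E) x,
    ContMDiffAt 𝓘(ℝ, E) 𝓘(ℝ, E).tangent ∞
      (fun y => (⟨y, V y⟩ : TangentBundle 𝓘(ℝ, E) M)) (γ t) ∧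
    (∀ᶠ s in 𝓝 t, V (γ s) = velocity γ s) ∧
    nabla V (γ t) (velocity γ t) = a

/-- The surface `i : L → M`, on which `g` is nondegenerate, is totally geodesic: each geodesic of
the induced connection of `L` (the tangential part of `∇`, so a curve with normal acceleration) is a
geodesic of `(M, g)`. -/
def IsTotallyGeodesic [IsManifold 𝓘(ℂ, E) ω M]
    (g : Π x : M, TangentSpace 𝓘(ℝ, E) x →L[ℝ] TangentSpace 𝓘(ℝ, E) x →L[ℝ] ℝ)
    (nabla : (Π x : M, TangentSpace 𝓘(ℝ, E) x) →
      (Π x : M, TangentSpace 𝓘(ℝ, E) x →L[ℝ] TangentSpace 𝓘(ℝ, E) x))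
    (i : L → M) : Prop :=
  ∀ (T : Set ℝ) (γ : ℝ → L), IsOpen T →
    ContMDiffOn 𝓘(ℝ, ℝ) 𝓘(ℝ, EuclideanSpace ℝ (Fin 2)) ∞ γ T →
    (∀ t ∈ T, ∃ a ∈ normalBundle g i (γ t), HasAcceleration nabla (fun s => i (γ s)) t a) →
    ∀ t ∈ T, HasAcceleration nabla (fun s => i (γ s)) t 0

/-- The radical `Rad T_p L = T_p L ∩ T_p L^⊥`. -/
def radical (g : Π x : M, TangentSpace 𝓘(ℝ, E) x →L[ℝ] TangentSpace 𝓘(ℝ, E) x →L[ℝ] ℝ)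
    (i : L → M) (p : L) : Submodule ℝ (TangentSpace 𝓘(ℝ, E) (i p)) :=
  tangentPlane i p ⊓ normalBundle g i p

/-- `L` is isotropic: the radical of its tangent bundle has rank `dim L`, and
`dim L < codim L`. -/
def IsIsotropic (g : Π x : M, TangentSpace 𝓘(ℝ, E) x →L[ℝ] TangentSpace 𝓘(ℝ, E) x →L[ℝ] ℝ)
    (i : L → M) : Prop :=
  ∀ p : L, Module.finrank ℝ (radical g i p) = Module.finrank ℝ (tangentPlane (E := E) i p) ∧
    Module.finrank ℝ (tangentPlane (E := E) i p) <
      Module.finrank ℝ (TangentSpace 𝓘(ℝ, E) (i p) ⧸ tangentPlane i p)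

/-- `L` is totally lightlike: the radical of its tangent bundle has rank
`dim L = codim L`. -/
def IsTotallyLightlike
    (g : Π x : M, TangentSpace 𝓘(ℝ, E) x →L[ℝ] TangentSpace 𝓘(ℝ, E) x →L[ℝ] ℝ)
    (i : L → M) : Prop :=
  ∀ p : L, Module.finrank ℝ (radical g i p) = Module.finrank ℝ (tangentPlane (E := E) i p) ∧
    Module.finrank ℝ (tangentPlane (E := E) i p) =
      Module.finrank ℝ (TangentSpace 𝓘(ℝ, E) (i p) ⧸ tangentPlane i p)

/-- `tr` is a transversal vector bundle of the isotropic surface `i : L → M` (`n = dim_ℂ M`):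
`tr = ltr ⊕ S` where the screen transversal bundle `S` is a smooth complement of `T(L)` in
`T(L)^⊥`, and the lightlike transversal bundle `ltr` is a smooth totally null complement of `T(L)`
in `S^⊥`. -/
def IsTransversalBundle [IsManifold 𝓘(ℂ, E) ω M]
    (g : Π x : M, TangentSpace 𝓘(ℝ, E) x →L[ℝ] TangentSpace 𝓘(ℝ, E) x →L[ℝ] ℝ) (n : ℕ)
    (i : L → M) (tr : Π p : L, Submodule ℝ (TangentSpace 𝓘(ℝ, E) (i p))) : Prop :=
  ∃ S ltr : Π p : L, Submodule ℝ (TangentSpace 𝓘(ℝ, E) (i p)),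
    IsSubbundleAlong i S (2 * n - 4) ∧ IsSubbundleAlong i ltr 2 ∧
    ∀ p : L,
      Disjoint (tangentPlane i p) (S p) ∧ tangentPlane i p ⊔ S p = normalBundle g i p ∧
      Disjoint (tangentPlane i p) (ltr p) ∧ tangentPlane i p ⊔ ltr p = perp g (i p) (S p) ∧
      (∀ v ∈ ltr p, ∀ w ∈ ltr p, g (i p) v w = 0) ∧
      tr p = ltr p ⊔ S p

end Surfaces

end Definitions

end LCK

end

open LCK

/-! Everything rests on the covariant derivatives of the two fields. Since ω is parallel and `g` is
nondegenerate, ∇B = 0, so g(B,B) has zero differential. Comparing ∇ with the Levi-Civita connections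
of the local Kähler metrics e^{-f}g (`conformal_change`) gives ∇J in terms of ω and B
(`nabla_complexStructure`). With ∇B = 0 this becomes ∇_v A = ½(g(B,B) Jv − g(v,A) B + ω(v) A), which
vanishes for v in P.

Thus A and B are both parallel in the directions of P, and ∇_v Y stays in P whenever v is in P and Y
lies in P along a map tangent to v (`nabla_mem_leePlane`). This one fact yields involutivity,
because ∇ is torsion free, and the vanishing of the second fundamental form with respect to every
complement of T(L). On P the metric is g(B,B) times a Euclidean one. For c ≠ 0 it is definite, so an
acceleration that is both tangent and normal is zero; for c = 0 the plane P is totally null and the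
remaining claims are linear algebra and a dimension count.

Integrability is obtained without a real Frobenius theorem. The formulas above show that bracketing
with B commutes with J, so B is a holomorphic vector field and P is the complex line field it spans.
Straightening B by a biholomorphism (`exists_straightening`) makes P constant. The flow in complex
time that this needs (`exists_holomorphic_flow`) comes from the inverse function theorem applied to
the integral equation on continuous paths over the unit interval, where the composition operator γ ↦
F ∘ γ is smooth (`contDiffOn_compOp`). -/

noncomputable section

namespace LCK

universe u

/-! ### Inverse functions and composition operators -/

section Calculus

/-- A smooth map with invertible derivative at a point restricts to a smooth local
diffeomorphism. -/
theorem exists_openPartialHomeomorph_contDiffOn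
    {E F : Type*} [NormedAddCommGroup E] [NormedSpace ℂ E] [CompleteSpace E]
    [NormedAddCommGroup F] [NormedSpace ℂ F]
    {f : E → F} {U : Set E} (hU : IsOpen U) (hf : ContDiffOn ℂ ∞ f U) {a : E} (ha : a ∈ U)
    {f' : E ≃L[ℂ] F} (hf' : HasFDerivAt f (f' : E →L[ℂ] F) a) :
    ∃ e : OpenPartialHomeomorph E F, a ∈ e.source ∧ e.source ⊆ U ∧ (∀ x, e x = f x) ∧
      ContDiffOn ℂ ∞ e.symm e.target := by
  have hfa : ContDiffAt ℂ ∞ f a := hf.contDiffAt (hU.mem_nhds ha)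
  let e₀ := hfa.toOpenPartialHomeomorph f hf' (by simp)
  have hD : ContinuousOn (fderiv ℂ f) U := hf.continuousOn_fderiv_of_isOpen hU (by simp)
  -- Invertible operators form an open set, so shrinking to the points with invertible derivative
  -- makes the inverse smooth on the whole target, not only near f(a).
  let V : Set E := U ∩ fderiv ℂ f ⁻¹' Set.range ((↑) : (E ≃L[ℂ] F) → E →L[ℂ] F)
  have hV : IsOpen V := hD.isOpen_inter_preimage hU ContinuousLinearEquiv.isOpen
  have haV : a ∈ V := ⟨ha, f', hf'.fderiv.symm⟩
  refine ⟨e₀.restrOpen V hV, ⟨hfa.mem_toOpenPartialHomeomorph_source hf' (by simp), haV⟩,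
    fun x hx => hx.2.1, fun x => rfl, fun y hy => ?_⟩
  have hx := (e₀.restrOpen V hV).map_target hy
  obtain ⟨g', hg'⟩ := hx.2.2
  refine ((e₀.restrOpen V hV).contDiffAt_symm (f₀' := g') hy ?_ ?_).contDiffWithinAt
  · rw [hg']
    exact ((hf.contDiffAt (hU.mem_nhds hx.2.1)).differentiableAt (by simp)).hasFDerivAt
  · exact hf.contDiffAt (hU.mem_nhds hx.2.1)

variable {K : Type*} [TopologicalSpace K] [CompactSpace K]

open Classical in
/-- The composition operator `γ ↦ F ∘ γ` on continuous maps, extended by zero to those `γ` for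
which `F ∘ γ` is not continuous. -/
def compOp {E G : Type*} [TopologicalSpace E] [TopologicalSpace G] [Zero G] (F : E → G)
    (γ : C(K, E)) : C(K, G) :=
  if h : Continuous (F ∘ γ) then ⟨F ∘ γ, h⟩ else 0

omit [CompactSpace K] in
theorem compOp_apply {E G : Type*} [TopologicalSpace E] [TopologicalSpace G] [Zero G]
    {F : E → G} {U : Set E} (hF : ContinuousOn F U) {γ : C(K, E)} (hγ : ∀ k, γ k ∈ U) (k : K) :
    compOp F γ k = F (γ k) := by
  have h : Continuous (F ∘ γ) := hF.comp_continuous γ.continuous hγ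
  simp [compOp, h]

section

variable {E G : Type*} [NormedAddCommGroup E] [NormedSpace ℂ E] [NormedAddCommGroup G]
  [NormedSpace ℂ G]

/-- Pointwise application of a field of linear maps, as a bounded bilinear map. -/
def pointwiseApply : C(K, E →L[ℂ] G) →L[ℂ] C(K, E) →L[ℂ] C(K, G) :=
  LinearMap.mkContinuous₂
    (LinearMap.mk₂ ℂ (fun (A : C(K, E →L[ℂ] G)) (h : C(K, E)) =>
      (⟨fun k => A k (h k), by fun_prop⟩ : C(K, G)))
      (by intros; ext; simp) (by intros; ext; simp) (by intros; ext; simp)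
      (by intros; ext; simp)) 1 (by
    intro A h
    rw [one_mul, ContinuousMap.norm_le _ (by positivity)]
    intro k
    exact (A k).le_of_opNorm_le_of_le (A.norm_coe_le_norm k) (h.norm_coe_le_norm k))

@[simp]
theorem pointwiseApply_apply (A : C(K, E →L[ℂ] G)) (h : C(K, E)) (k : K) :
    pointwiseApply A h k = A k (h k) := rfl

omit [NormedSpace ℂ E] in
theorem isOpen_forall_mem {U : Set E} (hU : IsOpen U) : IsOpen {γ : C(K, E) | ∀ k, γ k ∈ U} := by
  simpa [Set.MapsTo] using ContinuousMap.isOpen_setOfPred_mapsTo (isCompact_univ (X := K)) hU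

/-- The image of γ is compact, so `fderiv ℂ F` is uniformly continuous around it; the pointwise
linearization error is then o(‖h‖) uniformly in k, that is, in the sup norm. -/
theorem hasFDerivAt_compOp {F : E → G} {U : Set E} (hU : IsOpen U) (hF : ContDiffOn ℂ 1 F U)
    {γ : C(K, E)} (hγ : ∀ k, γ k ∈ U) :
    HasFDerivAt (compOp (K := K) F) (pointwiseApply (compOp (fderiv ℂ F) γ)) γ := by
  have hD : ContinuousOn (fderiv ℂ F) U := hF.continuousOn_fderiv_of_isOpen hU (by simp)
  have hcpt : IsCompact (Set.range γ) := isCompact_range γ.continuous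
  have hsub : Set.range γ ⊆ U := by rintro _ ⟨k, rfl⟩; exact hγ k
  rw [hasFDerivAt_iff_isLittleO_nhds_zero, Asymptotics.isLittleO_iff]
  intro c hc
  have h1 := hcpt.uniformContinuousAt_of_continuousAt (fderiv ℂ F)
    (fun a ha => hD.continuousAt (hU.mem_nhds (hsub ha))) (Metric.dist_mem_uniformity hc)
  obtain ⟨δ₁, hδ₁, h1⟩ := Metric.mem_uniformity_dist.1 h1
  obtain ⟨δ₂, hδ₂, h2⟩ := hcpt.exists_thickening_subset_open hU hsub
  filter_upwards [Metric.ball_mem_nhds (0 : C(K, E)) (lt_min hδ₁ hδ₂)] with h hh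
  rw [mem_ball_zero_iff, lt_min_iff] at hh
  have hball : ∀ k, ∀ y ∈ Metric.ball (γ k) (min δ₁ δ₂), y ∈ U := fun k y hy =>
    h2 (Metric.mem_thickening_iff.2 ⟨γ k, ⟨k, rfl⟩, (Metric.mem_ball.1 hy).trans_le (min_le_right _ _)⟩)
  have hmem : ∀ k, (γ + h) k ∈ Metric.ball (γ k) (min δ₁ δ₂) := fun k => by
    simpa [Metric.mem_ball, dist_eq_norm] using
      ⟨(h.norm_coe_le_norm k).trans_lt hh.1, (h.norm_coe_le_norm k).trans_lt hh.2⟩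
  rw [ContinuousMap.norm_le _ (by positivity)]
  intro k
  have hcomp : ∀ k, (γ + h) k ∈ U := fun k => hball k _ (hmem k)
  rw [ContinuousMap.sub_apply, ContinuousMap.sub_apply, compOp_apply hF.continuousOn hcomp,
    compOp_apply hF.continuousOn hγ, pointwiseApply_apply, compOp_apply hD hγ]
  -- Here δ₁ bounds the oscillation of the derivative by c and δ₂ keeps the ball inside U; neither
  -- depends on k.
  have hmv := (convex_ball (γ k) (min δ₁ δ₂)).norm_image_sub_le_of_norm_fderiv_le' (𝕜 := ℂ)
    (f := F) (φ := fderiv ℂ F (γ k)) (C := c) (x := γ k) (y := (γ + h) k)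
    (fun y hy => (hF.contDiffAt (hU.mem_nhds (hball k y hy))).differentiableAt (by simp))
    (fun y hy => by
      have := h1 (a := γ k) (b := y)
        (by rw [dist_comm]; exact (Metric.mem_ball.1 hy).trans_le (min_le_left _ _)) ⟨k, rfl⟩
      rw [Set.mem_ofPred_eq, dist_comm, dist_eq_norm] at this
      exact this.le)
    (Metric.mem_ball_self (lt_min hδ₁ hδ₂)) (hmem k)
  simp only [ContinuousMap.add_apply, add_sub_cancel_left] at hmv
  exact hmv.trans (by gcongr; exact h.norm_coe_le_norm k)

end

/-- The composition operator of a map of class `C^(n+1)` is of class `C^n`. -/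
theorem contDiffOn_compOp_nat {E : Type u} [NormedAddCommGroup E] [NormedSpace ℂ E] {U : Set E}
    (hU : IsOpen U) (n : ℕ) {G : Type u} [NormedAddCommGroup G] [NormedSpace ℂ G]
    {F : E → G} (hF : ContDiffOn ℂ (n + 1) F U) :
    ContDiffOn ℂ n (compOp (K := K) F) {γ | ∀ k, γ k ∈ U} := by
  induction n generalizing G with
  | zero =>
    rw [Nat.cast_zero, contDiffOn_zero]
    exact fun γ hγ => (hasFDerivAt_compOp hU (by simpa using hF)
      hγ).continuousAt.continuousWithinAt
  | succ n ih =>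
    have hF1 : ContDiffOn ℂ 1 F U := hF.of_le le_add_self
    rw [Nat.cast_succ, contDiffOn_succ_iff_fderiv_of_isOpen (isOpen_forall_mem hU)]
    refine ⟨fun γ hγ => (hasFDerivAt_compOp hU hF1 hγ).differentiableAt.differentiableWithinAt,
      by simp, ?_⟩
    rw [contDiffOn_succ_iff_fderiv_of_isOpen hU] at hF
    -- The derivative of the operator is the composition operator of `fderiv ℂ F` followed by a
    -- bounded linear map, so the induction has to change the target space.
    have ih' : ContDiffOn ℂ n (compOp (K := K) (fderiv ℂ F)) {γ | ∀ k, γ k ∈ U} :=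
      ih (by exact_mod_cast hF.2.2)
    have h := (ContinuousLinearMap.contDiff (n := n)
      (pointwiseApply : C(K, E →L[ℂ] G) →L[ℂ] C(K, E) →L[ℂ] C(K, G))).comp_contDiffOn ih'
    exact h.congr fun γ hγ => (hasFDerivAt_compOp hU hF1 hγ).fderiv

/-- The composition operator of a smooth map is smooth. -/
theorem contDiffOn_compOp {E : Type u} [NormedAddCommGroup E] [NormedSpace ℂ E] {U : Set E}
    (hU : IsOpen U) {G : Type u} [NormedAddCommGroup G] [NormedSpace ℂ G]
    {F : E → G} (hF : ContDiffOn ℂ ∞ F U) :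
    ContDiffOn ℂ ∞ (compOp (K := K) F) {γ | ∀ k, γ k ∈ U} :=
  contDiffOn_infty.2 fun n => contDiffOn_compOp_nat hU n (hF.of_le (by exact_mod_cast le_top))

end Calculus

/-! ### Flows of holomorphic vector fields -/

section Flow

variable {E : Type u} [NormedAddCommGroup E] [NormedSpace ℂ E] [CompleteSpace E]

/-- The primitive `t ↦ ∫ s in 0..t, h s` of a continuous map on the unit interval. -/
def primitive : C(unitInterval, E) →L[ℂ] C(unitInterval, E) :=
  LinearMap.mkContinuous
    { toFun := fun h => ⟨fun t => ∫ s in (0 : ℝ)..t, Set.IccExtend zero_le_one h s,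
        (intervalIntegral.continuous_primitive (fun a b =>
          (h.continuous.Icc_extend' (h := zero_le_one)).intervalIntegrable a b) 0).comp
          continuous_subtype_val⟩
      map_add' := fun h k => by
        ext t
        exact intervalIntegral.integral_add
          ((h.continuous.Icc_extend' (h := zero_le_one)).intervalIntegrable _ _)
          ((k.continuous.Icc_extend' (h := zero_le_one)).intervalIntegrable _ _)
      map_smul' := fun c h => by
        ext t
        exact intervalIntegral.integral_smul c _ } 1 (by
    intro h
    rw [one_mul, ContinuousMap.norm_le _ (norm_nonneg _)]
    intro t
    refine (intervalIntegral.norm_integral_le_of_norm_le_const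
      (fun s _ => h.norm_coe_le_norm (Set.projIcc 0 1 zero_le_one s))).trans ?_
    rw [sub_zero, abs_of_nonneg t.2.1]
    exact mul_le_of_le_one_right (norm_nonneg _) t.2.2)

omit [CompleteSpace E] in
theorem primitive_apply (h : C(unitInterval, E)) (t : unitInterval) :
    primitive h t = ∫ s in (0 : ℝ)..t, Set.IccExtend zero_le_one h s := rfl

omit [CompleteSpace E] in
/-- Primitives and rescaling of the time. -/
theorem primitive_rescale (h k : C(unitInterval, E)) (t : unitInterval)
    (hk : ∀ s, k s = h (t * s)) (s : unitInterval) :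
    (t : ℂ) • primitive k s = primitive h (t * s) := by
  rw [primitive_apply, primitive_apply, Complex.coe_smul, Set.Icc.coe_mul]
  have h1 := intervalIntegral.smul_integral_comp_mul_left (a := 0) (b := s)
    (Set.IccExtend zero_le_one h) (t : ℝ)
  rw [mul_zero] at h1
  rw [← h1]
  congr 1
  apply intervalIntegral.integral_congr
  intro r hr
  rw [Set.uIcc_of_le s.2.1] at hr
  have hr' : r ∈ Set.Icc (0 : ℝ) 1 := ⟨hr.1, hr.2.trans s.2.2⟩
  have htr : (t : ℝ) * r ∈ Set.Icc (0 : ℝ) 1 := unitInterval.mul_mem t.2 hr'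
  simp only [Set.IccExtend_of_mem _ _ hr', Set.IccExtend_of_mem _ _ htr, hk]
  rfl

/-- The local flow of a holomorphic vector field in complex time. -/
theorem exists_holomorphic_flow {F : E → E} {U : Set E} (hU : IsOpen U) (hF : ContDiffOn ℂ ∞ F U)
    {x₀ : E} (hx₀ : x₀ ∈ U) :
    ∃ (Φ : ℂ × E → E) (W : Set (ℂ × E)), IsOpen W ∧ ((0 : ℂ), x₀) ∈ W ∧ ContDiffOn ℂ ∞ Φ W ∧
      (∀ p ∈ W, Φ p ∈ U) ∧ (∀ x, ((0 : ℂ), x) ∈ W → Φ (0, x) = x) ∧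
      ∀ p ∈ W, fderiv ℂ Φ p (1, 0) = F (Φ p) := by
  let cst : E →L[ℂ] C(unitInterval, E) := ContinuousLinearMap.const ℂ unitInterval
  let Ω : Set ((ℂ × E) × C(unitInterval, E)) := {q | ∀ k, q.2 k ∈ U}
  have hΩ : IsOpen Ω := (isOpen_forall_mem hU).preimage continuous_snd
  -- For parameters (ε, x), the second component of `H` vanishes exactly when u(t) = x + ε ∫₀ᵗ F(u).
  -- The complex time ε enters only as a coefficient, so paths run over the fixed interval [0, 1].
  let G : (ℂ × E) × C(unitInterval, E) → C(unitInterval, E) :=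
    fun q => primitive (compOp F q.2)
  let H : (ℂ × E) × C(unitInterval, E) → (ℂ × E) × C(unitInterval, E) :=
    fun q => (q.1, q.2 - cst q.1.2 - q.1.1 • G q)
  have hG : ContDiffOn ℂ ∞ G Ω := by
    have : ContDiffOn ℂ ∞ (compOp F ∘ (Prod.snd : (ℂ × E) × C(unitInterval, E) → _)) Ω :=
      (contDiffOn_compOp hU hF).comp contDiff_snd.contDiffOn fun q hq => hq
    exact primitive.contDiff.comp_contDiffOn this
  have hH : ContDiffOn ℂ ∞ H Ω := by
    refine contDiffOn_fst.prodMk ((contDiffOn_snd.sub ?_).sub ?_)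
    · exact cst.contDiff.comp_contDiffOn (contDiff_snd.comp contDiff_fst).contDiffOn
    · exact (contDiff_fst.comp contDiff_fst).contDiffOn.smul hG
  let a : (ℂ × E) × C(unitInterval, E) := ((0, x₀), cst x₀)
  have ha : a ∈ Ω := fun k => hx₀
  let Λ : ℂ × E →L[ℂ] C(unitInterval, E) :=
    -(cst.comp (ContinuousLinearMap.snd ℂ ℂ E)) -
      (ContinuousLinearMap.fst ℂ ℂ E).smulRight (G a)
  -- At ε = 0 the integral term contributes nothing to the derivative in the path direction, so the
  -- derivative is block triangular with identity diagonal.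
  let H' := (ContinuousLinearEquiv.refl ℂ (ℂ × E)).skewProd
    (ContinuousLinearEquiv.refl ℂ C(unitInterval, E)) Λ
  have hH' : HasFDerivAt H (H' : _ →L[ℂ] _) a := by
    have hGa : HasFDerivAt G (fderiv ℂ G a) a :=
      ((hG.contDiffAt (hΩ.mem_nhds ha)).differentiableAt (by simp)).hasFDerivAt
    have h1 : HasFDerivAt (fun q : (ℂ × E) × C(unitInterval, E) => q.1)
      (ContinuousLinearMap.fst ℂ _ _) a := hasFDerivAt_fst
    have h2 : HasFDerivAt (fun q : (ℂ × E) × C(unitInterval, E) => q.2)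
      (ContinuousLinearMap.snd ℂ _ _) a := hasFDerivAt_snd
    have h3 := (h2.sub (cst.hasFDerivAt.comp a h1.snd)).sub (h1.fst.smul hGa)
    refine (h1.prodMk h3).congr_fderiv ?_
    ext q k <;> simp [H', Λ, a]
  obtain ⟨e, hae, heΩ, heH, hesymm⟩ := exists_openPartialHomeomorph_contDiffOn hΩ hH ha hH'
  let ψ : ℂ × E → C(unitInterval, E) := fun p => (e.symm (p, 0)).2
  let W₀ : Set (ℂ × E) := {p | (p, (0 : C(unitInterval, E))) ∈ e.target}
  have hW₀ : IsOpen W₀ := e.open_target.preimage (by fun_prop)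
  have hψ : ContDiffOn ℂ ∞ ψ W₀ :=
    contDiff_snd.comp_contDiffOn (hesymm.comp (by fun_prop) fun p hp => hp)
  have huniq : ∀ q ∈ e.source, (H q).2 = 0 → q.1 ∈ W₀ ∧ ψ q.1 = q.2 := by
    intro q hq h0
    have : e q = (q.1, 0) := by rw [heH]; exact Prod.ext rfl h0
    refine ⟨?_, ?_⟩
    · change (q.1, (0 : C(unitInterval, E))) ∈ e.target
      rw [← this]; exact e.map_source hq
    · change (e.symm (q.1, 0)).2 = q.2
      rw [← this, e.left_inv hq]
  have hsol : ∀ p ∈ W₀, (p, ψ p) ∈ e.source ∧ ψ p = cst p.2 + p.1 • G (p, ψ p) := by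
    intro p hp
    have h1 : H (e.symm (p, 0)) = (p, 0) := by rw [← heH]; exact e.right_inv hp
    have h2 : (e.symm (p, 0)).1 = p := congrArg Prod.fst h1
    have h3 : e.symm (p, 0) = (p, ψ p) := Prod.ext h2 rfl
    refine ⟨h3 ▸ e.map_target hp, ?_⟩
    rw [h3] at h1
    have h4 : ψ p - cst p.2 - p.1 • G (p, ψ p) = 0 := congrArg Prod.snd h1
    rw [sub_sub, sub_eq_zero] at h4
    exact h4
  obtain ⟨r, hr, hball⟩ := Metric.isOpen_iff.1 e.open_source a hae
  have ha0 : (H a).2 = 0 := by simp [H, a]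
  obtain ⟨ha1, ha2⟩ := huniq a hae ha0
  -- Requiring the solution path to stay in the ball around the constant path keeps its
  -- time-rescaled copies inside `e.source`, where solutions are unique.
  let W : Set (ℂ × E) := (W₀ ∩ ψ ⁻¹' Metric.ball (cst x₀) r) ∩ Metric.ball (0, x₀) r
  have hW : IsOpen W := (hψ.continuousOn.isOpen_inter_preimage hW₀ Metric.isOpen_ball).inter
    Metric.isOpen_ball
  have haW : ((0 : ℂ), x₀) ∈ W := by
    refine ⟨⟨ha1, ?_⟩, Metric.mem_ball_self hr⟩
    rw [Set.mem_preimage, ha2]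
    exact Metric.mem_ball_self hr
  -- rescaling of the time
  have hscale : ∀ p ∈ W, ∀ t : unitInterval,
      ((t : ℂ) * p.1, p.2) ∈ W ∧ ∀ s, ψ ((t : ℂ) * p.1, p.2) s = ψ p (t * s) := by
    rintro ⟨ε, x⟩ ⟨⟨hp0, hpψ⟩, hpb⟩ t
    let m : C(unitInterval, unitInterval) := ⟨fun s => t * s, by fun_prop⟩
    let η : C(unitInterval, E) := (ψ (ε, x)).comp m
    have hη : η ∈ Metric.ball (cst x₀) r := by
      rw [Metric.mem_ball, ContinuousMap.dist_lt_iff hr]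
      intro s
      exact (ContinuousMap.dist_apply_le_dist (f := ψ (ε, x)) (g := cst x₀) (t * s)).trans_lt hpψ
    have hb : ((t : ℂ) * ε, x) ∈ Metric.ball ((0 : ℂ), x₀) r := by
      rw [Metric.mem_ball, Prod.dist_eq, max_lt_iff] at hpb ⊢
      refine ⟨?_, hpb.2⟩
      have := hpb.1
      simp only [dist_zero_right, norm_mul] at this ⊢
      refine lt_of_le_of_lt ?_ this
      refine mul_le_of_le_one_left (norm_nonneg _) ?_
      rw [Complex.norm_real, Real.norm_eq_abs, abs_of_nonneg t.2.1]
      exact t.2.2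
    have hmem : (((t : ℂ) * ε, x), η) ∈ e.source :=
      hball (by rw [← ball_prod_same]; exact ⟨hb, hη⟩)
    have hΩ1 := heΩ (hsol _ hp0).1
    have hΩ2 := heΩ hmem
    have hG1 : ∀ s, ((t : ℂ) • G (((t : ℂ) * ε, x), η)) s = G ((ε, x), ψ (ε, x)) (t * s) :=
      primitive_rescale _ _ t fun s => by
        rw [compOp_apply hF.continuousOn hΩ2, compOp_apply hF.continuousOn hΩ1]; rfl
    -- The path s ↦ ψ(ε, x)(ts) solves the equation with parameter tε, so uniqueness identifies it
    -- with ψ(tε, x).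
    have hz : (H (((t : ℂ) * ε, x), η)).2 = 0 := by
      change η - cst x - ((t : ℂ) * ε) • G (((t : ℂ) * ε, x), η) = 0
      rw [sub_sub, sub_eq_zero]
      ext s
      have h2 := congrArg (fun γ : C(unitInterval, E) => γ (t * s)) (hsol _ hp0).2
      simp only [ContinuousMap.add_apply, ContinuousMap.smul_apply] at h2
      rw [ContinuousMap.add_apply, mul_comm, mul_smul, ContinuousMap.smul_apply, hG1]
      exact h2
    obtain ⟨hm1, hm2⟩ := huniq _ hmem hz
    refine ⟨⟨⟨hm1, ?_⟩, hb⟩, fun s => ?_⟩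
    · rw [Set.mem_preimage, hm2]; exact hη
    · rw [hm2]; rfl
  let ev : C(unitInterval, E) →L[ℂ] E := ContinuousMap.evalCLM ℂ (1 : unitInterval)
  let Φ : ℂ × E → E := fun p => ev (ψ p)
  have hΦ : ContDiffOn ℂ ∞ Φ W :=
    ev.contDiff.comp_contDiffOn (hψ.mono fun p hp => hp.1.1)
  -- By rescaling, Φ(tε, x) = ψ(ε, x)(t) = x + ε ∫₀ᵗ F(ψ(ε, x)); both sides are differentiated in
  -- the real variable t.
  have hderiv : ∀ p ∈ W, ∀ t : unitInterval,
      fderiv ℂ Φ ((t : ℂ) * p.1, p.2) (p.1, 0) = p.1 • F (Φ ((t : ℂ) * p.1, p.2)) := by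
    rintro ⟨ε, x⟩ hp t
    have hΩ1 := heΩ (hsol _ hp.1.1).1
    let h : C(unitInterval, E) := compOp F (ψ (ε, x))
    have hcont : Continuous (Set.IccExtend (zero_le_one (α := ℝ)) h) :=
      h.continuous.Icc_extend'
    have h1 : HasDerivWithinAt
        (fun s : ℝ => x + ε • ∫ r in (0 : ℝ)..s, Set.IccExtend zero_le_one h r)
        (ε • Set.IccExtend zero_le_one h t) (Set.Icc 0 1) t :=
      (((hcont.integral_hasStrictDerivAt 0 t).hasDerivAt.const_smul ε).const_add x).hasDerivWithinAt
    have h2 : HasDerivWithinAt (fun s : ℝ => Φ ((s : ℂ) * ε, x))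
        (fderiv ℂ Φ ((t : ℂ) * ε, x) (ε, 0)) (Set.Icc 0 1) t := by
      have hΦt : HasFDerivAt Φ (fderiv ℂ Φ ((t : ℂ) * ε, x)) ((t : ℂ) * ε, x) :=
        ((hΦ.contDiffAt (hW.mem_nhds (hscale _ hp t).1)).differentiableAt (by simp)).hasFDerivAt
      have hline : HasDerivAt (fun s : ℝ => ((s : ℂ) * ε, x)) (ε, (0 : E)) (t : ℝ) := by
        have : HasDerivAt (fun s : ℝ => (s : ℂ) * ε) ε (t : ℝ) := by
          simpa using (Complex.ofRealCLM.hasDerivAt (x := (t : ℝ))).mul_const ε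
        exact this.prodMk (hasDerivAt_const _ _)
      exact ((hΦt.restrictScalars ℝ).comp_hasDerivAt _ hline).hasDerivWithinAt
    have heq : ∀ s ∈ Set.Icc (0 : ℝ) 1, Φ ((s : ℂ) * ε, x) =
        x + ε • ∫ r in (0 : ℝ)..s, Set.IccExtend zero_le_one h r := by
      intro s hs
      have h3 := (hscale _ hp ⟨s, hs⟩).2 1
      have h4 := congrArg (fun γ : C(unitInterval, E) => γ ⟨s, hs⟩) (hsol _ hp.1.1).2
      rw [mul_one] at h3
      exact h3.trans h4
    have h5 := (uniqueDiffOn_Icc zero_lt_one _ t.2).eq_deriv _ h2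
      (h1.congr heq (heq _ t.2))
    rw [h5, Set.IccExtend_of_mem _ _ t.2, compOp_apply hF.continuousOn hΩ1]
    change _ = ε • F (ψ ((t : ℂ) * ε, x) 1)
    rw [(hscale _ hp t).2 1, mul_one]
  refine ⟨Φ, W, hW, haW, hΦ, fun p hp => heΩ (hsol p hp.1.1).1 1, fun x hx => ?_, ?_⟩
  · have h1 := congrArg (fun γ : C(unitInterval, E) => γ 1) (hsol _ hx.1.1).2
    simp only [zero_smul, add_zero] at h1
    exact h1
  · rintro ⟨ε, x⟩ hp
    -- For ε ≠ 0 take t = 1 and divide by ε. At ε = 0 that division fails, so a nearby nonzero time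
    -- δ/2 is used with t = 0.
    by_cases hε : ε = 0
    · subst hε
      obtain ⟨δ, hδ, hδW⟩ := Metric.isOpen_iff.1 hW _ hp
      have hδ0 : ((δ / 2 : ℝ) : ℂ) ≠ 0 := by exact_mod_cast (half_pos hδ).ne'
      have hmem : (((δ / 2 : ℝ) : ℂ), x) ∈ W := hδW (by
        rw [Metric.mem_ball, Prod.dist_eq, dist_self, max_lt_iff, dist_zero_right,
          Complex.norm_real, Real.norm_eq_abs, abs_of_pos (half_pos hδ)]
        exact ⟨half_lt_self hδ, hδ⟩)
      have h1 := hderiv _ hmem 0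
      simp only [Set.Icc.coe_zero, Complex.ofReal_zero, zero_mul] at h1
      rw [← smul_right_inj hδ0, ← h1, ← map_smul, Prod.smul_mk, smul_eq_mul, mul_one, smul_zero]
    · have h1 := hderiv _ hp 1
      simp only [Set.Icc.coe_one, Complex.ofReal_one, one_mul] at h1
      rw [← smul_right_inj hε, ← h1, ← map_smul, Prod.smul_mk, smul_eq_mul, mul_one, smul_zero]

/-- Straightening of a holomorphic vector field near a point where it does not vanish. -/
theorem exists_straightening {F : E → E} {U : Set E} (hU : IsOpen U) (hF : ContDiffOn ℂ ∞ F U)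
    {x₀ : E} (hx₀ : x₀ ∈ U) (h0 : F x₀ ≠ 0) :
    ∃ e : OpenPartialHomeomorph E E, x₀ ∈ e.target ∧ e.target ⊆ U ∧
      ContDiffOn ℂ ∞ e e.source ∧ ContDiffOn ℂ ∞ e.symm e.target ∧
      ∀ u ∈ e.source, fderiv ℂ e u (F x₀) = F (e u) := by
  obtain ⟨Φ, W, hW, h0W, hΦ, hΦU, hΦ0, hΦF⟩ := exists_holomorphic_flow hU hF hx₀
  obtain ⟨l, hl⟩ : ∃ l : E →L[ℂ] ℂ, l (F x₀) = 1 := SeparatingDual.exists_eq_one h0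
  -- Coordinates u ↦ (flow time, starting point): the time is l(u), and the starting point moves in
  -- x₀ + ker l, transverse to F(x₀). Hence moving along F(x₀) changes the time only.
  let D : E →L[ℂ] ℂ × E := l.prod (ContinuousLinearMap.id ℂ E - l.smulRight (F x₀))
  let j : E → ℂ × E := fun u => ((0 : ℂ), x₀) + D u
  have hjd : ∀ u, HasFDerivAt j D u := fun u => D.hasFDerivAt.const_add _
  have hj : ContDiff ℂ ∞ j := contDiff_const.add D.contDiff
  have hΨ : ContDiffOn ℂ ∞ (Φ ∘ j) (j ⁻¹' W) := hΦ.comp hj.contDiffOn fun u hu => hu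
  have hopen : IsOpen (j ⁻¹' W) := hW.preimage hj.continuous
  have hj0 : j 0 = (0, x₀) := by simp [j]
  have hmem : (0 : E) ∈ j ⁻¹' W := by rw [Set.mem_preimage, hj0]; exact h0W
  have hΦd : ∀ p ∈ W, HasFDerivAt Φ (fderiv ℂ Φ p) p := fun p hp =>
    ((hΦ.contDiffAt (hW.mem_nhds hp)).differentiableAt (by simp)).hasFDerivAt
  have hΨd : ∀ u ∈ j ⁻¹' W, HasFDerivAt (Φ ∘ j) ((fderiv ℂ Φ (j u)).comp D) u :=
    fun u hu => (hΦd _ hu).comp u (hjd u)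
  have hDF : D (F x₀) = (1, 0) := by simp [D, hl]
  have hspace : ∀ w : E, fderiv ℂ Φ (0, x₀) (0, w) = w := by
    intro w
    have h1 : HasFDerivAt (fun x : E => ((0 : ℂ), x)) (ContinuousLinearMap.inr ℂ ℂ E) x₀ :=
      (ContinuousLinearMap.inr ℂ ℂ E).hasFDerivAt
    have h2 := (hΦd _ h0W).comp x₀ h1
    have h3 : (Φ ∘ fun x : E => ((0 : ℂ), x)) =ᶠ[𝓝 x₀] id := by
      have : ∀ᶠ x in 𝓝 x₀, ((0 : ℂ), x) ∈ W :=
        (by fun_prop : Continuous fun x : E => ((0 : ℂ), x)).continuousAt.eventually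
          (hW.mem_nhds h0W)
      filter_upwards [this] with x hx using hΦ0 x hx
    have h4 := h2.unique ((hasFDerivAt_id x₀).congr_of_eventuallyEq h3)
    exact DFunLike.congr_fun h4 w
  have hΨ0 : HasFDerivAt (Φ ∘ j) (ContinuousLinearEquiv.refl ℂ E : E →L[ℂ] E) 0 := by
    refine (hΨd 0 hmem).congr_fderiv ?_
    ext u
    rw [hj0]
    have h1 : D u = l u • ((1 : ℂ), (0 : E)) + (0, u - l u • F x₀) := by
      ext <;> simp [D]
    have h2 := hΦF _ h0W
    rw [ContinuousLinearMap.comp_apply, h1, map_add, map_smul, h2, hspace, hΦ0 _ h0W]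
    simp
  obtain ⟨e, h0e, heW, heΨ, hesymm⟩ := exists_openPartialHomeomorph_contDiffOn hopen hΨ hmem hΨ0
  have hee : (e : E → E) = Φ ∘ j := funext heΨ
  refine ⟨e, ?_, ?_, ?_, hesymm, ?_⟩
  · have h1 := e.map_source h0e
    rwa [hee, Function.comp_apply, hj0, hΦ0 _ h0W] at h1
  · intro y hy
    rw [← e.right_inv hy, hee]
    exact hΦU _ (heW (e.map_target hy))
  · rw [hee]; exact hΨ.mono heW
  · intro u hu
    rw [hee, (hΨd u (heW hu)).fderiv, ContinuousLinearMap.comp_apply, hDF, hΦF _ (heW hu)]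
    rfl

end Flow

/-! ### Complex smoothness from real smoothness and complex linear derivatives -/

/-- The second real derivative is complex linear in its second argument, because first derivatives
are complex linear, and hence by symmetry also in its first. So the complex derivative is itself
complex differentiable, and the induction needs no Cauchy formula. -/
theorem contDiffOn_complex_nat {E : Type u} [NormedAddCommGroup E] [NormedSpace ℂ E]
    [FiniteDimensional ℂ E] {U : Set E} (hU : IsOpen U) (n : ℕ) {G : Type u}
    [NormedAddCommGroup G] [NormedSpace ℂ G] [FiniteDimensional ℂ G] {F : E → G}
    (hF : ContDiffOn ℝ ∞ F U) (hF' : ∀ x ∈ U, DifferentiableAt ℂ F x) : ContDiffOn ℂ n F U := by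
  induction n generalizing G with
  | zero =>
    rw [Nat.cast_zero, contDiffOn_zero]
    exact hF.continuousOn
  | succ n ih =>
    rw [Nat.cast_succ, contDiffOn_succ_iff_fderiv_of_isOpen hU]
    refine ⟨fun x hx => (hF' x hx).differentiableWithinAt, by simp, ?_⟩
    have : FiniteDimensional ℝ E := FiniteDimensional.complexToReal E
    have : FiniteDimensional ℝ G := FiniteDimensional.complexToReal G
    let r : (E →L[ℂ] G) →L[ℝ] (E →L[ℝ] G) := ContinuousLinearMap.restrictScalarsL ℂ E G ℝ ℝ
    have hr : Function.Injective r := fun A B h => by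
      ext v; exact DFunLike.congr_fun h v
    -- A left inverse of restriction of scalars transfers real smoothness from the real derivative
    -- to the complex one.
    obtain ⟨C, hC⟩ := (r : (E →L[ℂ] G) →ₗ[ℝ] (E →L[ℝ] G)).exists_leftInverse_of_injective
      (LinearMap.ker_eq_bot.2 hr)
    have heq : ∀ x ∈ U, fderiv ℝ F x = r (fderiv ℂ F x) := fun x hx =>
      ((hF' x hx).hasFDerivAt.restrictScalars ℝ).fderiv
    have hDF : ContDiffOn ℝ ∞ (fderiv ℝ F) U := hF.fderiv_of_isOpen hU (by simp)
    have hDF' : ContDiffOn ℝ ∞ (fderiv ℂ F) U := by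
      refine (C.toContinuousLinearMap.contDiff.comp_contDiffOn hDF).congr fun x hx => ?_
      rw [Function.comp_apply, heq x hx]
      exact (LinearMap.congr_fun hC (fderiv ℂ F x)).symm
    refine ih hDF' fun x hx => ?_
    have hdiff : DifferentiableAt ℝ (fderiv ℂ F) x :=
      (hDF'.contDiffAt (hU.mem_nhds hx)).differentiableAt (by simp)
    let A := fderiv ℝ (fderiv ℂ F) x
    have hA : fderiv ℝ (fderiv ℝ F) x = r.comp A := by
      have h1 : fderiv ℝ F =ᶠ[𝓝 x] r ∘ fderiv ℂ F := by
        filter_upwards [hU.mem_nhds hx] with y hy using heq y hy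
      rw [h1.fderiv_eq]
      exact (r.hasFDerivAt.comp x hdiff.hasFDerivAt).fderiv
    have hsymm : ∀ v w, A v w = A w v := by
      have h1 : IsSymmSndFDerivAt ℝ F x :=
        ((contDiffOn_infty.1 hF 2).contDiffAt (hU.mem_nhds hx)).isSymmSndFDerivAt (by simp)
      intro v w
      have h2 := h1 v w
      rw [hA] at h2
      exact h2
    let A' : E →L[ℂ] E →L[ℂ] G :=
      { toFun := A
        map_add' := map_add A
        map_smul' := fun c v => by
          ext w
          rw [hsymm, map_smul, hsymm]; rfl
        cont := A.continuous }
    exact (hasFDerivAt_of_restrictScalars ℝ (f' := A') hdiff.hasFDerivAt rfl).differentiableAt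

/-- A smooth map in the real sense with complex linear derivatives is smooth in the complex
sense. -/
theorem contDiffOn_complex {E : Type u} [NormedAddCommGroup E] [NormedSpace ℂ E]
    [FiniteDimensional ℂ E] {U : Set E} (hU : IsOpen U) {F : E → E} (hF : ContDiffOn ℝ ∞ F U)
    (hF' : ∀ x ∈ U, ∀ v, fderiv ℝ F x (Complex.I • v) = Complex.I • fderiv ℝ F x v) :
    ContDiffOn ℂ ∞ F U := by
  refine contDiffOn_infty.2 fun n => contDiffOn_complex_nat hU n hF fun x hx => ?_
  have hd : HasFDerivAt F (fderiv ℝ F x) x :=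
    ((hF.contDiffAt (hU.mem_nhds hx)).differentiableAt (by simp)).hasFDerivAt
  let A : E →L[ℂ] E :=
    { toFun := fderiv ℝ F x
      map_add' := map_add _
      map_smul' := fun c v => by
        simp only [RingHom.id_apply]
        conv_lhs => rw [← Complex.re_add_im c]
        conv_rhs => rw [← Complex.re_add_im c]
        rw [add_smul, add_smul, map_add, mul_smul, mul_smul, Complex.coe_smul, Complex.coe_smul,
          Complex.coe_smul, Complex.coe_smul, map_smul, map_smul, hF' x hx]
      cont := (fderiv ℝ F x).continuous }
  exact (hasFDerivAt_of_restrictScalars ℝ (f' := A) hd rfl).differentiableAt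

/-! ### Smooth vector fields and the complex structure in charts -/

section VectorFields

variable {E : Type*} [NormedAddCommGroup E] [NormedSpace ℂ E]
  {M : Type*} [TopologicalSpace M] [ChartedSpace E M]

/-- The vector field `X` is smooth at `x`. -/
abbrev IsSmoothAt [IsManifold 𝓘(ℂ, E) ω M] (X : Π x : M, TangentSpace 𝓘(ℝ, E) x) (x : M) : Prop :=
  ContMDiffAt 𝓘(ℝ, E) 𝓘(ℝ, E).tangent ∞ (fun y => (⟨y, X y⟩ : TangentBundle 𝓘(ℝ, E) M)) x

variable [IsManifold 𝓘(ℂ, E) ω M]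

omit [IsManifold 𝓘(ℂ, E) ω M] in
theorem complexStructure_complexStructure (x : M) (v : TangentSpace 𝓘(ℝ, E) x) :
    complexStructure x (complexStructure x v) = -v := by
  change Complex.I • (Complex.I • (show E from v)) = -(show E from v)
  rw [smul_smul, Complex.I_mul_I, neg_one_smul]

/-- The coordinate changes of the tangent bundle are complex linear. -/
theorem tangentCoordChange_I_smul {x y z : M} (hx : z ∈ (chartAt E x).source)
    (hy : z ∈ (chartAt E y).source) (v : E) :
    tangentCoordChange 𝓘(ℝ, E) x y z (Complex.I • v) =
      Complex.I • tangentCoordChange 𝓘(ℝ, E) x y z v := by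
  have h1 := hasFDerivWithinAt_tangentCoordChange (I := 𝓘(ℝ, E)) (x := x) (y := y) (z := z)
    (by simpa using ⟨hx, hy⟩)
  have : IsManifold 𝓘(ℂ, E) 1 M := .of_le (n := ω) le_top
  have h2 := (hasFDerivWithinAt_tangentCoordChange (I := 𝓘(ℂ, E)) (x := x) (y := y) (z := z)
    (by simpa using ⟨hx, hy⟩)).restrictScalars ℝ
  simp only [mfld_simps, hasFDerivWithinAt_univ] at h1 h2
  rw [h1.unique h2]
  simp

theorem tangentCoordChange_complexStructure {x y : M} (hx : y ∈ (chartAt E x).source)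
    (v : TangentSpace 𝓘(ℝ, E) y) :
    tangentCoordChange 𝓘(ℝ, E) y x y (complexStructure y v) =
      Complex.I • tangentCoordChange 𝓘(ℝ, E) y x y v :=
  tangentCoordChange_I_smul (mem_chart_source E y) hx v

theorem isSmoothAt_iff {X : Π x : M, TangentSpace 𝓘(ℝ, E) x} {x x₀ : M}
    (hx : x ∈ (chartAt E x₀).source) :
    IsSmoothAt X x ↔ ContMDiffAt 𝓘(ℝ, E) 𝓘(ℝ, E) ∞
      (fun y => tangentCoordChange 𝓘(ℝ, E) y x₀ y (X y)) x :=
  (trivializationAt E (TangentSpace 𝓘(ℝ, E)) x₀).contMDiffAt_section_iff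
    (IB := 𝓘(ℝ, E)) (n := ∞) (s := X) hx

theorem isDiffAt_iff {X : Π x : M, TangentSpace 𝓘(ℝ, E) x} {x x₀ : M}
    (hx : x ∈ (chartAt E x₀).source) :
    IsDiffAt X x ↔ MDifferentiableAt 𝓘(ℝ, E) 𝓘(ℝ, E)
      (fun y => tangentCoordChange 𝓘(ℝ, E) y x₀ y (X y)) x :=
  (trivializationAt E (TangentSpace 𝓘(ℝ, E)) x₀).mdifferentiableAt_section_iff
    (IB := 𝓘(ℝ, E)) (s := X) hx

theorem IsSmoothAt.isDiffAt {X : Π x : M, TangentSpace 𝓘(ℝ, E) x} {x : M} (hX : IsSmoothAt X x) :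
    IsDiffAt X x :=
  hX.mdifferentiableAt (by simp)

theorem IsSmoothAt.complexStructure {X : Π x : M, TangentSpace 𝓘(ℝ, E) x} {x : M}
    (hX : IsSmoothAt X x) : IsSmoothAt (fun y => complexStructure y (X y)) x := by
  rw [isSmoothAt_iff (mem_chart_source E x)] at hX ⊢
  refine (((Complex.I • ContinuousLinearMap.id ℂ E).restrictScalars ℝ).contMDiff.contMDiffAt.comp x
    hX).congr_of_eventuallyEq ?_
  filter_upwards [(chartAt E x).open_source.mem_nhds (mem_chart_source E x)] with y hy
  exact tangentCoordChange_complexStructure hy (X y)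

theorem IsDiffAt.complexStructure {X : Π x : M, TangentSpace 𝓘(ℝ, E) x} {x : M}
    (hX : IsDiffAt X x) : IsDiffAt (fun y => complexStructure y (X y)) x := by
  rw [isDiffAt_iff (mem_chart_source E x)] at hX ⊢
  refine ((((Complex.I • ContinuousLinearMap.id ℂ E).restrictScalars
    ℝ).contMDiff (n := 1)).contMDiffAt.mdifferentiableAt one_ne_zero |>.comp x
    hX).congr_of_eventuallyEq ?_
  filter_upwards [(chartAt E x).open_source.mem_nhds (mem_chart_source E x)] with y hy
  exact tangentCoordChange_complexStructure hy (X y)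

/-- The axioms of a connection speak of fields; extending single vectors allows them to be tested
against `g` at one point. -/
theorem exists_isSmoothAt (x : M) (v : TangentSpace 𝓘(ℝ, E) x) :
    ∃ X : Π x : M, TangentSpace 𝓘(ℝ, E) x, IsSmoothAt X x ∧ X x = v :=
  ⟨FiberBundle.extend E v, FiberBundle.contMDiffAt_extend 𝓘(ℝ, E) E v, by simp⟩

theorem IsSmoothAt.metric {g : Π x : M, TangentSpace 𝓘(ℝ, E) x →L[ℝ] TangentSpace 𝓘(ℝ, E) x →L[ℝ] ℝ}
    {ν : ℕ} (hg : IsHermitianMetric g ν) {X Y : Π x : M, TangentSpace 𝓘(ℝ, E) x} {x : M}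
    (hX : IsSmoothAt X x) (hY : IsSmoothAt Y x) :
    ContMDiffAt 𝓘(ℝ, E) 𝓘(ℝ, ℝ) ∞ (fun y => g y (X y) (Y y)) x := by
  have h := ContMDiffAt.clm_bundle_apply₂ (F₁ := E) (F₂ := E) (F₃ := ℝ) (IB := 𝓘(ℝ, E))
    (E₃ := fun _ : M => ℝ) (b := id) hg.contMDiff.contMDiffAt hX hY
  simp only [Bundle.contMDiffAt_totalSpace] at h
  exact h.2

theorem IsDiffAt.metric {g : Π x : M, TangentSpace 𝓘(ℝ, E) x →L[ℝ] TangentSpace 𝓘(ℝ, E) x →L[ℝ] ℝ}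
    {ν : ℕ} (hg : IsHermitianMetric g ν) {X Y : Π x : M, TangentSpace 𝓘(ℝ, E) x} {x : M}
    (hX : IsDiffAt X x) (hY : IsDiffAt Y x) :
    MDifferentiableAt 𝓘(ℝ, E) 𝓘(ℝ, ℝ) (fun y => g y (X y) (Y y)) x := by
  have h := MDifferentiableAt.clm_bundle_apply₂ (F₁ := E) (F₂ := E) (F₃ := ℝ) (IB := 𝓘(ℝ, E))
    (E₃ := fun _ : M => ℝ) (b := id) ((hg.contMDiff.contMDiffAt (x := x)).mdifferentiableAt
      (by simp)) hX hY
  simp only [mdifferentiableAt_totalSpace] at h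
  exact h.2

end VectorFields

/-! ### Smoothness of the Lee field -/

section LeeField

variable {E : Type*} [NormedAddCommGroup E] [NormedSpace ℂ E]
  {M : Type*} [TopologicalSpace M] [ChartedSpace E M] [IsManifold 𝓘(ℂ, E) ω M]
  {g : Π x : M, TangentSpace 𝓘(ℝ, E) x →L[ℝ] TangentSpace 𝓘(ℝ, E) x →L[ℝ] ℝ} {ν : ℕ}

theorem contMDiffAt_mvfderiv {f : M → ℝ} {x : M} (hf : ContMDiffAt 𝓘(ℝ, E) 𝓘(ℝ, ℝ) ∞ f x) :
    ContMDiffAt 𝓘(ℝ, E) (𝓘(ℝ, E).prod 𝓘(ℝ, E →L[ℝ] ℝ)) ∞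
      (fun y => Bundle.TotalSpace.mk' (E →L[ℝ] ℝ)
        (E := fun y : M => TangentSpace 𝓘(ℝ, E) y →L[ℝ] ℝ) y (mvfderiv 𝓘(ℝ, E) f y)) x := by
  rw [contMDiffAt_hom_bundle]
  refine ⟨contMDiffAt_id, (hf.mfderiv_const (m := ∞) (by simp)).congr_of_eventuallyEq ?_⟩
  filter_upwards [(chartAt E x).open_source.mem_nhds (mem_chart_source E x)] with y hy
  ext v
  simp only [inTangentCoordinates, ContinuousLinearMap.inCoordinates, ContinuousLinearMap.comp_apply,
    TangentBundle.continuousLinearMapAt_model_space]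
  simp
  rfl

theorem IsHermitianMetric.isInvertible [FiniteDimensional ℂ E] (hg : IsHermitianMetric g ν)
    (x : M) : (show E →L[ℝ] E →L[ℝ] ℝ from g x).IsInvertible := by
  have : FiniteDimensional ℝ E := FiniteDimensional.complexToReal E
  let G : E →L[ℝ] E →L[ℝ] ℝ := g x
  have hinj : Function.Injective (G : E →ₗ[ℝ] E →L[ℝ] ℝ) := by
    rw [← LinearMap.ker_eq_bot, LinearMap.ker_eq_bot']
    intro v hv
    exact hg.nondegenerate x v fun w => DFunLike.congr_fun hv w
  have hdim : Module.finrank ℝ E = Module.finrank ℝ (E →L[ℝ] ℝ) := by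
    rw [← (LinearMap.toContinuousLinearMap (𝕜 := ℝ) (E := E) (F' := ℝ)).finrank_eq]
    exact (Subspace.dual_finrank_eq).symm
  exact ⟨(LinearEquiv.ofInjectiveOfFinrankEq _ hinj hdim).toContinuousLinearEquiv, rfl⟩

/-- The Lee field is smooth. -/
theorem IsLeeField.isSmoothAt [FiniteDimensional ℂ E] (hg : IsHermitianMetric g ν)
    {lee : Π x : M, TangentSpace 𝓘(ℝ, E) x →L[ℝ] ℝ} (hlck : IsLocallyConformalKahler g lee)
    {B : Π x : M, TangentSpace 𝓘(ℝ, E) x} (hB : IsLeeField g lee B) (x : M) : IsSmoothAt B x := by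
  have : FiniteDimensional ℝ E := FiniteDimensional.complexToReal E
  obtain ⟨U, f, hU, hxU, hf, -, hlee⟩ := hlck x
  have hl := contMDiffAt_mvfderiv (hf.contMDiffAt (hU.mem_nhds hxU))
  have hG := (contMDiffAt_hom_bundle _).1 (hg.contMDiff.contMDiffAt (x := x))
  rw [Bundle.contMDiffAt_section] at hl
  let T := trivializationAt E (TangentSpace 𝓘(ℝ, E)) x
  let T' := trivializationAt (E →L[ℝ] ℝ) (fun y : M => TangentSpace 𝓘(ℝ, E) y →L[ℝ] ℝ) x
  let G : M → E →L[ℝ] E →L[ℝ] ℝ := fun y =>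
    ContinuousLinearMap.inCoordinates E (TangentSpace 𝓘(ℝ, E))
      (E →L[ℝ] ℝ) (fun y : M => TangentSpace 𝓘(ℝ, E) y →L[ℝ] ℝ) x y x y (g y)
  have hGs : ContMDiffAt 𝓘(ℝ, E) 𝓘(ℝ, E →L[ℝ] E →L[ℝ] ℝ) ∞ G x := hG.2
  have hT : ∀ y ∈ (chartAt E x).source, y ∈ T.baseSet := fun y hy => hy
  have hT' : ∀ y ∈ (chartAt E x).source, y ∈ T'.baseSet := fun y hy => by
    simpa [T'] using hy
  have hinv : ∀ y ∈ (chartAt E x).source, (G y).IsInvertible := by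
    intro y hy
    obtain ⟨e, he⟩ := hg.isInvertible y
    let e' : TangentSpace 𝓘(ℝ, E) y ≃L[ℝ] (TangentSpace 𝓘(ℝ, E) y →L[ℝ] ℝ) := e
    refine ⟨((T.continuousLinearEquivAt ℝ y (hT y hy)).symm.trans e').trans
      (T'.continuousLinearEquivAt ℝ y (hT' y hy)), ?_⟩
    have h1 : G y = _ := ContinuousLinearMap.inCoordinates_eq (hT y hy) (hT' y hy)
    rw [h1]
    ext v w
    have h2 : ∀ u : TangentSpace 𝓘(ℝ, E) y, e' u = g y u := fun u => DFunLike.congr_fun he u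
    simp [h2]
    rfl
  have hGB : ∀ y ∈ (chartAt E x).source, ∀ v : TangentSpace 𝓘(ℝ, E) y,
      G y (T ⟨y, v⟩).2 = (T' ⟨y, g y v⟩).2 := by
    intro y hy v
    have h1 : G y = _ := ContinuousLinearMap.inCoordinates_eq (hT y hy) (hT' y hy)
    have h2 : (T ⟨y, v⟩).2 = T.continuousLinearEquivAt ℝ y (hT y hy) v := rfl
    rw [h1, h2]
    simp only [ContinuousLinearMap.comp_apply, ContinuousLinearEquiv.coe_coe]
    erw [ContinuousLinearEquiv.symm_apply_apply]
    rfl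
  refine (Bundle.contMDiffAt_section _).2 ?_
  have hx := mem_chart_source E x
  -- In trivializations B is the inverse of the metric applied to df, and inversion of operators is
  -- smooth.
  have h3 : ContMDiffAt 𝓘(ℝ, E) 𝓘(ℝ, (E →L[ℝ] ℝ) →L[ℝ] E) ∞ (fun y => (G y).inverse) x :=
    ((hinv x hx).contDiffAt_map_inverse (n := ∞)).contMDiffAt.comp x hGs
  refine (h3.clm_apply hl).congr_of_eventuallyEq ?_
  filter_upwards [(chartAt E x).open_source.mem_nhds hx, hU.mem_nhds hxU] with y hy hyU
  refine Eq.symm ((hinv y hy).inverse_apply_eq.2 ?_)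
  have h4 : g y (B y) = mvfderiv 𝓘(ℝ, E) f y := by
    rw [← hlee y hyU]
    ext v
    rw [hg.symm, hB]
  exact (congrArg (fun l => (T' ⟨y, l⟩).2) h4).symm.trans (hGB y hy (B y)).symm

end LeeField

/-! ### Covariant derivatives of B, J and A -/

section Connections

variable {E : Type*} [NormedAddCommGroup E] [NormedSpace ℂ E]
  {M : Type*} [TopologicalSpace M] [ChartedSpace E M] [IsManifold 𝓘(ℂ, E) ω M]
  {g : Π x : M, TangentSpace 𝓘(ℝ, E) x →L[ℝ] TangentSpace 𝓘(ℝ, E) x →L[ℝ] ℝ} {ν : ℕ}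
  {lee : Π x : M, TangentSpace 𝓘(ℝ, E) x →L[ℝ] ℝ}
  {nabla : (Π x : M, TangentSpace 𝓘(ℝ, E) x) →
      (Π x : M, TangentSpace 𝓘(ℝ, E) x →L[ℝ] TangentSpace 𝓘(ℝ, E) x)}
  {B : Π x : M, TangentSpace 𝓘(ℝ, E) x}

theorem IsLeeField.apply_left (hg : IsHermitianMetric g ν) (hB : IsLeeField g lee B) (x : M)
    (v : TangentSpace 𝓘(ℝ, E) x) : g x (B x) v = lee x v := by
  rw [hg.symm, hB]

theorem IsHermitianMetric.complexStructure_left (hg : IsHermitianMetric g ν) (x : M)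
    (v w : TangentSpace 𝓘(ℝ, E) x) :
    g x (complexStructure x v) w = -g x v (complexStructure x w) := by
  have h := hg.hermitian x v (complexStructure x w)
  rw [complexStructure_complexStructure, map_neg] at h
  linarith

theorem IsHermitianMetric.complexStructure_self (hg : IsHermitianMetric g ν) (x : M)
    (v : TangentSpace 𝓘(ℝ, E) x) : g x (complexStructure x v) v = 0 := by
  have h := hg.complexStructure_left x v v
  rw [hg.symm x v] at h
  linarith

/-- The Lee field is parallel. -/
theorem IsLeeField.nabla_eq_zero (hg : IsHermitianMetric g ν)
    (hnabla : IsLeviCivitaOn g nabla Set.univ) (hlee : IsParallelForm nabla lee)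
    (hB : IsLeeField g lee B) {x : M} (hBx : IsDiffAt B x) : nabla B x = 0 := by
  ext1 v
  refine hg.nondegenerate x _ fun w => ?_
  obtain ⟨Y, hY, rfl⟩ := exists_isSmoothAt x w
  have h1 := hlee x Y hY.isDiffAt v
  have h2 := hnabla.metric x trivial Y B hY.isDiffAt hBx v
  -- As g(Y,B) = ω(Y), the Leibniz rules for `g` and for the parallel form ω differ exactly by g(Y,
  -- ∇_v B).
  simp only [hB _ _] at h2
  rw [hg.symm]
  linarith

theorem mvfderiv_leeField_sq_eq_zero (hg : IsHermitianMetric g ν)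
    (hnabla : IsLeviCivitaOn g nabla Set.univ) (hlee : IsParallelForm nabla lee)
    (hB : IsLeeField g lee B) {x : M} (hBx : IsDiffAt B x) :
    mvfderiv 𝓘(ℝ, E) (fun y => g y (B y) (B y)) x = 0 := by
  ext v
  rw [hnabla.metric x trivial B B hBx hBx v, hB.nabla_eq_zero hg hnabla hlee hBx]
  simp

/-- The conformal change of the Levi-Civita connection. -/
theorem conformal_change (hg : IsHermitianMetric g ν)
    (hnabla : IsLeviCivitaOn g nabla Set.univ) (hB : IsLeeField g lee B)
    {U : Set M} {f : M → ℝ}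
    {nabla' : (Π x : M, TangentSpace 𝓘(ℝ, E) x) →
      (Π x : M, TangentSpace 𝓘(ℝ, E) x →L[ℝ] TangentSpace 𝓘(ℝ, E) x)}
    (h' : IsLeviCivitaOn (fun y => Real.exp (-f y) • g y) nabla' U)
    {x : M} (hx : x ∈ U) (hf : MDifferentiableAt 𝓘(ℝ, E) 𝓘(ℝ, ℝ) f x)
    (hlee : lee x = mvfderiv 𝓘(ℝ, E) f x) {Y : Π x : M, TangentSpace 𝓘(ℝ, E) x}
    (hY : IsDiffAt Y x) (v : TangentSpace 𝓘(ℝ, E) x) :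
    nabla' Y x v = nabla Y x v -
      (2⁻¹ : ℝ) • (lee x v • Y x + lee x (Y x) • v - g x v (Y x) • B x) := by
  -- `S` is the defect of the claimed formula. Torsion-freeness makes g(S(X,Y),Z) symmetric in X, Y;
  -- compatibility with the two metrics makes it skew in Y, Z. A trilinear expression with both
  -- symmetries vanishes.
  let S : (Π x : M, TangentSpace 𝓘(ℝ, E) x) → (Π x : M, TangentSpace 𝓘(ℝ, E) x) →
      TangentSpace 𝓘(ℝ, E) x := fun X Y => nabla' Y x (X x) - nabla Y x (X x) +
      (2⁻¹ : ℝ) • (lee x (X x) • Y x + lee x (Y x) • X x - g x (X x) (Y x) • B x)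
  have hsymm : ∀ X Y, IsDiffAt X x → IsDiffAt Y x → S X Y = S Y X := by
    intro X Y hX hY
    have h1 := hnabla.torsionFree x trivial X Y hX hY
    have h2 := h'.torsionFree x hx X Y hX hY
    have h3 : nabla' Y x (X x) - nabla Y x (X x) = nabla' X x (Y x) - nabla X x (Y x) := by
      rw [← h1] at h2
      rw [sub_eq_sub_iff_add_eq_add] at h2 ⊢
      rw [h2, add_comm]
    simp only [S, h3, hg.symm x (X x) (Y x)]
    rw [add_comm (lee x (X x) • Y x)]
  have hskew : ∀ X Y Z, IsDiffAt X x → IsDiffAt Y x → IsDiffAt Z x →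
      g x (S X Y) (Z x) + g x (Y x) (S X Z) = 0 := by
    intro X Y Z hX hY hZ
    have h1 := hnabla.metric x trivial Y Z hY hZ (X x)
    have h2 := h'.metric x hx Y Z hY hZ (X x)
    have h3 : mvfderiv 𝓘(ℝ, E) (fun y => (Real.exp (-f y) • g y) (Y y) (Z y)) x (X x) =
        Real.exp (-f x) * (mvfderiv 𝓘(ℝ, E) (fun y => g y (Y y) (Z y)) x (X x)
          - lee x (X x) * g x (Y x) (Z x)) := by
      have hgd := hY.metric hg hZ
      have hd : MDifferentiableAt 𝓘(ℝ, ℝ) 𝓘(ℝ, ℝ) Real.exp ((-f) x) :=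
        Real.differentiable_exp.mdifferentiable.mdifferentiableAt
      have hexp : MDifferentiableAt 𝓘(ℝ, E) 𝓘(ℝ, ℝ) (fun y => Real.exp (-f y)) x :=
        hd.comp x hf.neg
      have hexp' : mvfderiv 𝓘(ℝ, E) (fun y => Real.exp (-f y)) x (X x) =
          -(Real.exp (-f x) * lee x (X x)) := by
        have h5 : mvfderiv 𝓘(ℝ, E) (Real.exp ∘ (-f)) x (X x) =
            fderiv ℝ Real.exp (-f x) (mvfderiv 𝓘(ℝ, E) (-f) x (X x)) := by
          rw [mvfderiv_comp_apply x hd hf.neg (X x), mvfderiv, mfderiv_eq_fderiv]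
          rfl
        rw [hlee]
        refine h5.trans ?_
        rw [mvfderiv_neg, (Real.hasDerivAt_exp _).hasFDerivAt.fderiv]
        simp [mul_comm]
      have h6 := mvfderiv_mul hexp hgd
      have h7 : (fun y => (Real.exp (-f y) • g y) (Y y) (Z y)) =
        (fun y => Real.exp (-f y)) * fun y => g y (Y y) (Z y) := rfl
      rw [h7, h6]
      simp only [_root_.add_apply, _root_.smul_apply, smul_eq_mul, hexp']
      ring
    rw [h3, h1] at h2
    simp only [_root_.smul_apply, smul_eq_mul] at h2
    have h4 : g x (nabla Y x (X x)) (Z x) + g x (Y x) (nabla Z x (X x)) -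
        lee x (X x) * g x (Y x) (Z x) =
        g x (nabla' Y x (X x)) (Z x) + g x (Y x) (nabla' Z x (X x)) :=
      mul_left_cancel₀ (Real.exp_ne_zero (-f x)) (by rw [h2]; ring)
    simp only [S, map_add, map_sub, map_smul, _root_.add_apply,
      _root_.sub_apply, _root_.smul_apply, smul_eq_mul, hB _ _,
      hB.apply_left hg]
    rw [hg.symm x (Y x) (X x)]
    linarith
  obtain ⟨X, hX, rfl⟩ := exists_isSmoothAt x v
  have hzero : S X Y = 0 := by
    refine hg.nondegenerate x _ fun w => ?_
    obtain ⟨Z, hZ, rfl⟩ := exists_isSmoothAt x w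
    replace hX := hX.isDiffAt
    replace hZ := hZ.isDiffAt
    have e1 := hskew X Y Z hX hY hZ
    have e2 := hskew Y Z X hY hZ hX
    have e3 := hskew Z X Y hZ hX hY
    rw [hsymm X Z hX hZ] at e1
    rw [hsymm Y X hY hX] at e2
    rw [hsymm Z Y hZ hY] at e3
    have f1 := hg.symm x (Y x) (S Z X)
    have f2 := hg.symm x (Z x) (S X Y)
    have f3 := hg.symm x (X x) (S Y Z)
    linarith
  have : nabla' Y x (X x) = S X Y + nabla Y x (X x) -
      (2⁻¹ : ℝ) • (lee x (X x) • Y x + lee x (Y x) • X x - g x (X x) (Y x) • B x) := by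
    simp only [S]; abel
  rw [this, hzero, zero_add]

/-- The covariant derivative of the complex structure of a locally conformal Kähler manifold. -/
theorem nabla_complexStructure (hg : IsHermitianMetric g ν)
    (hlck : IsLocallyConformalKahler g lee)
    (hnabla : IsLeviCivitaOn g nabla Set.univ) (hB : IsLeeField g lee B)
    {x : M} {Y : Π x : M, TangentSpace 𝓘(ℝ, E) x}
    (hY : IsDiffAt Y x) (v : TangentSpace 𝓘(ℝ, E) x) :
    nabla (fun y => complexStructure y (Y y)) x v = complexStructure x (nabla Y x v) +
      (2⁻¹ : ℝ) • (lee x (complexStructure x (Y x)) • v - lee x (Y x) • complexStructure x v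
        - g x v (complexStructure x (Y x)) • B x + g x v (Y x) • complexStructure x (B x)) := by
  obtain ⟨U, f, hU, hxU, hf, ⟨nabla', h', hJ⟩, hlee⟩ := hlck x
  have hfx := (hf.contMDiffAt (hU.mem_nhds hxU)).mdifferentiableAt (by simp)
  have h1 := conformal_change hg hnabla hB h' hxU hfx (hlee x hxU) hY v
  have h2 := conformal_change hg hnabla hB h' hxU hfx (hlee x hxU) hY.complexStructure v
  have h3 := hJ x hxU Y hY v
  rw [h1, h2] at h3
  simp only [map_sub, map_add, map_smul] at h3
  rw [sub_eq_iff_eq_add] at h3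
  rw [h3]
  module

/-- This is the formula for ∇J applied to B: the term J∇B drops out because B is parallel, and ω(JB)
= g(JB,B) = 0. -/
theorem nabla_antiLee (hg : IsHermitianMetric g ν)
    (hlck : IsLocallyConformalKahler g lee)
    (hnabla : IsLeviCivitaOn g nabla Set.univ) (hlee : IsParallelForm nabla lee)
    (hB : IsLeeField g lee B)
    {x : M} (hBx : IsDiffAt B x) (v : TangentSpace 𝓘(ℝ, E) x) :
    nabla (antiLee B) x v = (2⁻¹ : ℝ) • (g x (B x) (B x) • complexStructure x v
        - g x v (antiLee B x) • B x + lee x v • antiLee B x) := by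
  have h1 := nabla_complexStructure hg hlck hnabla hB hBx v
  have h2 : antiLee B = (-1 : ℝ) • fun y => complexStructure y (B y) := by
    ext y; simp [antiLee]
  have h3 := hnabla.isCovariantDerivativeOn.smul_const (-1 : ℝ) hBx.complexStructure
  rw [h2, h3, _root_.smul_apply, h1, hB.nabla_eq_zero hg hnabla hlee hBx]
  have h4 : lee x (complexStructure x (B x)) = 0 := by
    rw [← hB, hg.complexStructure_self]
  simp only [h4, hB x v, hB x (B x), _root_.zero_apply, map_zero,
    Pi.smul_apply, map_smul, smul_eq_mul]
  module

/-- The Lee field and the anti-Lee field are parallel along the Lee plane. -/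
theorem nabla_antiLee_eq_zero (hg : IsHermitianMetric g ν)
    (hlck : IsLocallyConformalKahler g lee)
    (hnabla : IsLeviCivitaOn g nabla Set.univ) (hlee : IsParallelForm nabla lee)
    (hB : IsLeeField g lee B) {x : M} (hBx : IsDiffAt B x) {v : TangentSpace 𝓘(ℝ, E) x}
    (hv : v ∈ leePlane B x) : nabla (antiLee B) x v = 0 := by
  obtain ⟨a, b, rfl⟩ := Submodule.mem_span_pair.1 hv
  have h1 := hg.hermitian x (B x) (B x)
  have h2 := hg.complexStructure_self x (B x)
  have h3 : g x (B x) (complexStructure x (B x)) = 0 := by rw [hg.symm, h2]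
  -- For v = A the terms cancel by JA = B and g(A,A) = g(B,B); for v = B they cancel by JB = −A and
  -- g(B,A) = 0.
  rw [nabla_antiLee hg hlck hnabla hlee hB hBx]
  simp only [antiLee, ← hB.apply_left hg x, map_add, map_smul, map_neg, _root_.add_apply,
    _root_.smul_apply, _root_.neg_apply, complexStructure_complexStructure, h1, h3, smul_eq_mul]
  module

end Connections

/-! ### The Lee plane is parallel along maps tangent to it -/

section Tangency

variable {E : Type*} [NormedAddCommGroup E] [NormedSpace ℂ E]
  {M : Type*} [TopologicalSpace M] [ChartedSpace E M]
  {g : Π x : M, TangentSpace 𝓘(ℝ, E) x →L[ℝ] TangentSpace 𝓘(ℝ, E) x →L[ℝ] ℝ} {ν : ℕ}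
  {lee : Π x : M, TangentSpace 𝓘(ℝ, E) x →L[ℝ] ℝ}
  {nabla : (Π x : M, TangentSpace 𝓘(ℝ, E) x) →
      (Π x : M, TangentSpace 𝓘(ℝ, E) x →L[ℝ] TangentSpace 𝓘(ℝ, E) x)}
  {B : Π x : M, TangentSpace 𝓘(ℝ, E) x}

theorem antiLee_mem_leePlane (x : M) : antiLee B x ∈ leePlane B x :=
  Submodule.subset_span (by simp)

theorem leeField_mem_leePlane (x : M) : B x ∈ leePlane B x :=
  Submodule.subset_span (by simp)

theorem range_vecCons_pair {α : Type*} (a b : α) : Set.range ![a, b] = {a, b} := by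
  simp [Set.pair_comm]

/-- `A` and `B` are linearly independent where `B` does not vanish. -/
theorem linearIndependent_antiLee {x : M} (hx : B x ≠ 0) :
    LinearIndependent ℝ ![antiLee B x, B x] := by
  rw [LinearIndependent.pair_iff]
  intro s t h
  -- The combination sA + tB is the complex multiple (t − si)B.
  have h1 : ((t : ℂ) - s * Complex.I) • (show E from B x) = 0 := by
    rw [sub_smul, mul_smul, Complex.coe_smul, Complex.coe_smul, sub_eq_neg_add, ← smul_neg]
    exact h
  have h2 := (smul_eq_zero.1 h1).resolve_right hx
  have h3 := congrArg Complex.re h2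
  have h4 := congrArg Complex.im h2
  simp at h3 h4
  exact ⟨h4, h3⟩

theorem finrank_leePlane {x : M} (hx : B x ≠ 0) : Module.finrank ℝ (leePlane B x) = 2 := by
  rw [leePlane, ← range_vecCons_pair]
  simpa using finrank_span_eq_card (linearIndependent_antiLee hx)

variable [IsManifold 𝓘(ℂ, E) ω M]

theorem IsSmoothAt.antiLee {x : M} (hB : IsSmoothAt B x) : IsSmoothAt (antiLee B) x :=
  hB.complexStructure.neg_section

/-- The covariant derivative of a vector field along a vector tangent to a map vanishes if the
vector field vanishes along the map. -/
theorem IsLeviCivitaOn.eq_zero_of_eventually_eq_zero (hg : IsHermitianMetric g ν)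
    (hnabla : IsLeviCivitaOn g nabla Set.univ)
    {F H N : Type*} [NormedAddCommGroup F] [NormedSpace ℝ F] [TopologicalSpace H]
    {I : ModelWithCorners ℝ F H} [TopologicalSpace N] [ChartedSpace H N] {j : N → M} {p : N}
    (hj : MDifferentiableAt I 𝓘(ℝ, E) j p) (v : TangentSpace I p)
    {Z : Π x : M, TangentSpace 𝓘(ℝ, E) x} (hZ : IsDiffAt Z (j p)) (h0 : ∀ᶠ q in 𝓝 p, Z (j q) = 0) :
    nabla Z (j p) (mfderiv I 𝓘(ℝ, E) j p v) = 0 := by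
  refine hg.nondegenerate _ _ fun w => ?_
  obtain ⟨W, hW, rfl⟩ := exists_isSmoothAt (j p) w
  have h1 := hnabla.metric (j p) trivial Z W hZ hW.isDiffAt (mfderiv I 𝓘(ℝ, E) j p v)
  -- The function g(Z,W) vanishes along j, and the term with ∇W drops out since Z is zero at the
  -- point; what remains is g(∇Z, W) = 0.
  have h2 : (fun x => g x (Z x) (W x)) ∘ j =ᶠ[𝓝 p] fun _ => 0 := by
    filter_upwards [h0] with q hq
    simp [hq]
  have h3 := mvfderiv_comp_apply p (hZ.metric hg hW.isDiffAt) hj v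
  rw [← h3, h0.self_of_nhds] at h1
  have h4 : mvfderiv I ((fun x => g x (Z x) (W x)) ∘ j) p v = 0 := by
    rw [mvfderiv, h2.mfderiv_eq, mfderiv_const]
    rfl
  rw [h4] at h1
  simpa using h1.symm

/-- The Lee plane is parallel along maps tangent to it. -/
theorem nabla_mem_leePlane (hg : IsHermitianMetric g ν)
    (hlck : IsLocallyConformalKahler g lee)
    (hnabla : IsLeviCivitaOn g nabla Set.univ) (hlee : IsParallelForm nabla lee)
    (hB : IsLeeField g lee B)
    {F H N : Type*} [NormedAddCommGroup F] [NormedSpace ℝ F] [TopologicalSpace H]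
    {I : ModelWithCorners ℝ F H} [TopologicalSpace N] [ChartedSpace H N] {j : N → M} {p : N}
    (hj : MDifferentiableAt I 𝓘(ℝ, E) j p) {v : TangentSpace I p}
    (hv : mfderiv I 𝓘(ℝ, E) j p v ∈ leePlane B (j p)) (hBs : IsSmoothAt B (j p))
    (hBp : B (j p) ≠ 0) {Y : Π x : M, TangentSpace 𝓘(ℝ, E) x} (hY : IsDiffAt Y (j p))
    (hYP : ∀ᶠ q in 𝓝 p, Y (j q) ∈ leePlane B (j q)) :
    nabla Y (j p) (mfderiv I 𝓘(ℝ, E) j p v) ∈ leePlane B (j p) := by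
  obtain ⟨w, hw⟩ : ∃ w, g (j p) (B (j p)) w ≠ 0 := by
    by_contra! h
    exact hBp (hg.nondegenerate _ _ h)
  obtain ⟨W, hW, rfl⟩ := exists_isSmoothAt (j p) w
  have hWd := hW.isDiffAt
  have hBd := hBs.isDiffAt
  have hAd := hBs.antiLee.isDiffAt
  let α : M → ℝ := fun x => g x (W x) (antiLee B x)
  let β : M → ℝ := fun x => g x (W x) (B x)
  let s : M → ℝ := fun x => g x (W x) (Y x)
  let t : M → ℝ := fun x => g x (complexStructure x (W x)) (Y x)
  have hα : MDifferentiableAt 𝓘(ℝ, E) 𝓘(ℝ, ℝ) α (j p) := hWd.metric hg hAd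
  have hβ : MDifferentiableAt 𝓘(ℝ, E) 𝓘(ℝ, ℝ) β (j p) := hWd.metric hg hBd
  have hs : MDifferentiableAt 𝓘(ℝ, E) 𝓘(ℝ, ℝ) s (j p) := hWd.metric hg hY
  have ht : MDifferentiableAt 𝓘(ℝ, E) 𝓘(ℝ, ℝ) t (j p) := hWd.complexStructure.metric hg hY
  -- Y is a section of P only along j, so its coefficients need ambient extensions. If Y = kA + lB,
  -- pairing with W and JW gives s = kα + lβ and t = lα − kβ. Cramer's rule yields Dk = −a and Dl =
  -- −b, so DY + aA + bB vanishes along j. The choice of W makes β, and hence D, nonzero at the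
  -- point.
  let D : M → ℝ := α * α + β * β
  let a : M → ℝ := t * β - s * α
  let b : M → ℝ := -(s * β + t * α)
  have hD : MDifferentiableAt 𝓘(ℝ, E) 𝓘(ℝ, ℝ) D (j p) := (hα.mul hα).add (hβ.mul hβ)
  have ha : MDifferentiableAt 𝓘(ℝ, E) 𝓘(ℝ, ℝ) a (j p) := (ht.mul hβ).sub (hs.mul hα)
  have hb : MDifferentiableAt 𝓘(ℝ, E) 𝓘(ℝ, ℝ) b (j p) := ((hs.mul hβ).add (ht.mul hα)).neg
  have hD0 : D (j p) ≠ 0 := by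
    have : β (j p) ≠ 0 := by rw [← hg.symm] at hw; exact hw
    change α (j p) * α (j p) + β (j p) * β (j p) ≠ 0
    exact (add_pos_of_nonneg_of_pos (mul_self_nonneg _) (mul_self_pos.2 this)).ne'
  have hDY : IsDiffAt (D • Y) (j p) := hD.smul_section hY
  have haA : IsDiffAt (a • antiLee B) (j p) := ha.smul_section hAd
  have hbB : IsDiffAt (b • B) (j p) := hb.smul_section hBd
  have hsum : IsDiffAt (a • antiLee B + b • B) (j p) := mdifferentiableAt_add_section haA hbB
  have hZ : IsDiffAt (D • Y + (a • antiLee B + b • B)) (j p) :=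
    mdifferentiableAt_add_section hDY hsum
  have h0 : ∀ᶠ q in 𝓝 p, (D • Y + (a • antiLee B + b • B)) (j q) = 0 := by
    filter_upwards [hYP] with q hq
    obtain ⟨k, l, hkl⟩ := Submodule.mem_span_pair.1 hq
    have hs' : s (j q) = k * α (j q) + l * β (j q) := by
      simp only [s, ← hkl, map_add, map_smul, smul_eq_mul]; rfl
    have ht' : t (j q) = -(k * β (j q)) + l * α (j q) := by
      simp only [t, α, β, ← hkl, map_add, map_smul, smul_eq_mul, antiLee, map_neg,
        hg.complexStructure_left, complexStructure_complexStructure]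
      ring
    change (α (j q) * α (j q) + β (j q) * β (j q)) • Y (j q) +
      ((t (j q) * β (j q) - s (j q) * α (j q)) • antiLee B (j q) +
        (-(s (j q) * β (j q) + t (j q) * α (j q))) • B (j q)) = 0
    rw [hs', ht', ← hkl]
    module
  have key := hnabla.eq_zero_of_eventually_eq_zero hg hj v hZ h0
  have hcov := hnabla.isCovariantDerivativeOn
  rw [hcov.add hDY hsum, hcov.add haA hbB, hcov.leibniz hY hD, hcov.leibniz hAd ha,
    hcov.leibniz hBd hb] at key
  set u := mfderiv I 𝓘(ℝ, E) j p v
  simp only [_root_.add_apply, _root_.smul_apply, ContinuousLinearMap.smulRight_apply,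
    nabla_antiLee_eq_zero hg hlck hnabla hlee hB hBd hv, hB.nabla_eq_zero hg hnabla hlee hBd,
    smul_zero, zero_add] at key
  have hYp : Y (j p) ∈ leePlane B (j p) := hYP.self_of_nhds
  -- After the Leibniz rule only derivatives of coefficients survive besides D∇Y, and these multiply
  -- Y, A and B, which all lie in P.
  have h5 : D (j p) • nabla Y (j p) u ∈ leePlane B (j p) := by
    rw [add_assoc] at key
    rw [eq_neg_of_add_eq_zero_left key]
    refine Submodule.neg_mem _ (Submodule.add_mem _ (Submodule.smul_mem _ _ hYp)
      (Submodule.add_mem _ (Submodule.smul_mem _ _ (antiLee_mem_leePlane _))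
        (Submodule.smul_mem _ _ (leeField_mem_leePlane _))))
  exact (Submodule.smul_mem_iff _ hD0).1 h5

end Tangency

/-! ### Vector fields and Lie brackets in a holomorphic chart -/

section ChartRepresentation

variable {E : Type*} [NormedAddCommGroup E] [NormedSpace ℂ E]
  {M : Type*} [TopologicalSpace M] [ChartedSpace E M] [IsManifold 𝓘(ℂ, E) ω M]

/-- The vector field `X` read in the preferred chart at `x₀`. -/
def chartRep (X : Π x : M, TangentSpace 𝓘(ℝ, E) x) (x₀ : M) (u : E) : E :=
  tangentCoordChange 𝓘(ℝ, E) ((chartAt E x₀).symm u) x₀ ((chartAt E x₀).symm u)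
    (X ((chartAt E x₀).symm u))

/-- The vector field which is constant in the preferred chart at `x₀`. -/
def constField (x₀ : M) (v : E) (y : M) : TangentSpace 𝓘(ℝ, E) y :=
  tangentCoordChange 𝓘(ℝ, E) x₀ y y v

theorem tangentCoordChange_tangentCoordChange {x₀ y : M} (hy : y ∈ (chartAt E x₀).source) (v : E) :
    tangentCoordChange 𝓘(ℝ, E) x₀ y y (tangentCoordChange 𝓘(ℝ, E) y x₀ y v) = v := by
  rw [tangentCoordChange_comp (by simpa using hy), tangentCoordChange_self (by simp)]

theorem tangentCoordChange_tangentCoordChange' {x₀ y : M} (hy : y ∈ (chartAt E x₀).source) (v : E) :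
    tangentCoordChange 𝓘(ℝ, E) y x₀ y (tangentCoordChange 𝓘(ℝ, E) x₀ y y v) = v := by
  rw [tangentCoordChange_comp (by simpa using hy), tangentCoordChange_self (by simpa using hy)]

theorem contDiffOn_chartRep {X : Π x : M, TangentSpace 𝓘(ℝ, E) x} (x₀ : M)
    (hX : ∀ x, IsSmoothAt X x) :
    ContDiffOn ℝ ∞ (chartRep X x₀) (chartAt E x₀).target := by
  rw [← contMDiffOn_iff_contDiffOn]
  intro u hu
  have hy := (chartAt E x₀).map_target hu
  have h1 := (isSmoothAt_iff hy).1 (hX _)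
  have h2 : ContMDiffWithinAt 𝓘(ℝ, E) 𝓘(ℝ, E) ∞ (chartAt E x₀).symm (chartAt E x₀).target u :=
    contMDiffOn_chart_symm u hu
  exact h1.comp_contMDiffWithinAt u h2

theorem isSmoothAt_constField {x₀ y : M} (hy : y ∈ (chartAt E x₀).source) (v : E) :
    IsSmoothAt (constField x₀ v) y := by
  rw [isSmoothAt_iff hy]
  refine (contMDiffAt_const (c := v)).congr_of_eventuallyEq ?_
  filter_upwards [(chartAt E x₀).open_source.mem_nhds hy] with z hz
  exact tangentCoordChange_tangentCoordChange' hz v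

theorem mpullback_chartAt {x₀ y : M} (hy : y ∈ (chartAt E x₀).source)
    (F : Π u : E, TangentSpace 𝓘(ℝ, E) u) :
    VectorField.mpullback 𝓘(ℝ, E) 𝓘(ℝ, E) (chartAt E x₀) F y =
      tangentCoordChange 𝓘(ℝ, E) x₀ y y (F (chartAt E x₀ y)) := by
  have : (tangentCoordChange 𝓘(ℝ, E) y x₀ y).inverse = tangentCoordChange 𝓘(ℝ, E) x₀ y y := by
    apply ContinuousLinearMap.inverse_eq
    · ext v
      exact tangentCoordChange_tangentCoordChange' hy v
    · ext v
      exact tangentCoordChange_tangentCoordChange hy v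
  rw [VectorField.mpullback_apply, mfderiv_chartAt_eq_tangentCoordChange hy]
  exact congrArg (fun T : E →L[ℝ] E => T (F (chartAt E x₀ y))) this

theorem chartRep_chartAt (X : Π x : M, TangentSpace 𝓘(ℝ, E) x) {x₀ y : M}
    (hy : y ∈ (chartAt E x₀).source) :
    chartRep X x₀ (chartAt E x₀ y) = tangentCoordChange 𝓘(ℝ, E) y x₀ y (X y) := by
  rw [chartRep, (chartAt E x₀).left_inv hy]

/-- The Lie bracket with a vector field which is constant in a chart. -/
theorem mlieBracket_constField [CompleteSpace E] {X : Π x : M, TangentSpace 𝓘(ℝ, E) x} {x₀ y : M}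
    (hX : ∀ x, IsSmoothAt X x) (hy : y ∈ (chartAt E x₀).source) (v : E) :
    VectorField.mlieBracket 𝓘(ℝ, E) X (constField x₀ v) y =
      -tangentCoordChange 𝓘(ℝ, E) x₀ y y (fderiv ℝ (chartRep X x₀) (chartAt E x₀ y) v) := by
  have hU := (chartAt E x₀).open_source.mem_nhds hy
  let F : Π u : E, TangentSpace 𝓘(ℝ, E) u := chartRep X x₀
  let G : Π u : E, TangentSpace 𝓘(ℝ, E) u := fun _ => v
  have h1 : X =ᶠ[𝓝 y] VectorField.mpullback 𝓘(ℝ, E) 𝓘(ℝ, E) (chartAt E x₀) F := by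
    filter_upwards [hU] with z hz
    rw [mpullback_chartAt hz]
    simp only [F]
    rw [chartRep_chartAt X hz]
    exact (tangentCoordChange_tangentCoordChange hz (X z)).symm
  have h2 : constField x₀ v =ᶠ[𝓝 y]
      VectorField.mpullback 𝓘(ℝ, E) 𝓘(ℝ, E) (chartAt E x₀) G := by
    filter_upwards [hU] with z hz
    rw [mpullback_chartAt hz]
    rfl
  have hF : ContDiffAt ℝ ∞ F (chartAt E x₀ y) :=
    (contDiffOn_chartRep x₀ hX).contDiffAt ((chartAt E x₀).open_target.mem_nhds
      ((chartAt E x₀).map_source hy))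
  have : IsManifold 𝓘(ℝ, E) (minSmoothness ℝ 3) M := .of_le (n := ω) le_top
  have h3 := VectorField.mpullback_mlieBracket (I := 𝓘(ℝ, E)) (I' := 𝓘(ℝ, E)) (n := ω)
    (f := chartAt E x₀) (x₀ := y) (V := F) (W := G)
    ((contMDiffAt_vectorSpace_iff_contDiffAt.2 hF).mdifferentiableAt (by simp : (∞ : ℕ∞ω) ≠ 0))
    ((contMDiffAt_vectorSpace_iff_contDiffAt (V := G) (n := ∞)).2 contDiffAt_const
      |>.mdifferentiableAt (by simp))
    (contMDiffOn_chart.contMDiffAt hU) le_top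
  rw [h1.mlieBracket_vectorField_eq h2, ← h3, mpullback_chartAt hy]
  rw [← VectorField.mlieBracketWithin_univ, VectorField.mlieBracketWithin_eq_lieBracketWithin,
    VectorField.lieBracketWithin_univ, VectorField.lieBracket]
  have h4 : fderiv ℝ G (chartAt E x₀ y) = 0 := fderiv_const_apply v
  rw [h4]
  exact (congrArg (tangentCoordChange 𝓘(ℝ, E) x₀ y y)
    (zero_sub (fderiv ℝ (chartRep X x₀) (chartAt E x₀ y) v))).trans (map_neg _ _)

end ChartRepresentation

/-! ### Holomorphy of the Lee field and foliated charts -/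

section FoliatedChart

variable {E : Type u} [NormedAddCommGroup E] [NormedSpace ℂ E]
  {M : Type*} [TopologicalSpace M] [ChartedSpace E M] [IsManifold 𝓘(ℂ, E) ω M]
  {g : Π x : M, TangentSpace 𝓘(ℝ, E) x →L[ℝ] TangentSpace 𝓘(ℝ, E) x →L[ℝ] ℝ} {ν : ℕ}
  {lee : Π x : M, TangentSpace 𝓘(ℝ, E) x →L[ℝ] ℝ}
  {nabla : (Π x : M, TangentSpace 𝓘(ℝ, E) x) →
      (Π x : M, TangentSpace 𝓘(ℝ, E) x →L[ℝ] TangentSpace 𝓘(ℝ, E) x)}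
  {B : Π x : M, TangentSpace 𝓘(ℝ, E) x}

/-- The Lie derivative along the parallel Lee field commutes with the complex structure. -/
theorem mlieBracket_leeField_complexStructure (hg : IsHermitianMetric g ν)
    (hlck : IsLocallyConformalKahler g lee)
    (hnabla : IsLeviCivitaOn g nabla Set.univ) (hlee : IsParallelForm nabla lee)
    (hB : IsLeeField g lee B) {x : M} (hBx : IsDiffAt B x)
    {X : Π x : M, TangentSpace 𝓘(ℝ, E) x} (hX : IsDiffAt X x) :
    VectorField.mlieBracket 𝓘(ℝ, E) B (fun y => complexStructure y (X y)) x =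
      complexStructure x (VectorField.mlieBracket 𝓘(ℝ, E) B X x) := by
  -- Since ∇B = 0, the bracket [B, X] is ∇_B X, and the correction terms in the formula for ∇_v J
  -- cancel at v = B.
  rw [← hnabla.torsionFree x trivial B _ hBx hX.complexStructure,
    ← hnabla.torsionFree x trivial B _ hBx hX, hB.nabla_eq_zero hg hnabla hlee hBx,
    nabla_complexStructure hg hlck hnabla hB hX, hB.apply_left hg, hB.apply_left hg]
  simp only [_root_.zero_apply, sub_zero]
  module

/-- The parallel Lee field is holomorphic: its derivative in a holomorphic chart is complex
linear. -/
theorem fderiv_chartRep_I_smul [CompleteSpace E] (hg : IsHermitianMetric g ν)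
    (hlck : IsLocallyConformalKahler g lee)
    (hnabla : IsLeviCivitaOn g nabla Set.univ) (hlee : IsParallelForm nabla lee)
    (hB : IsLeeField g lee B) (hBs : ∀ x, IsSmoothAt B x) (x₀ : M) {u : E}
    (hu : u ∈ (chartAt E x₀).target) (v : E) :
    fderiv ℝ (chartRep B x₀) u (Complex.I • v) =
      Complex.I • fderiv ℝ (chartRep B x₀) u v := by
  set y := (chartAt E x₀).symm u with hy'
  have hy : y ∈ (chartAt E x₀).source := (chartAt E x₀).map_target hu
  have hyu : chartAt E x₀ y = u := (chartAt E x₀).right_inv hu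
  have h1 (w : E) : fderiv ℝ (chartRep B x₀) u w = tangentCoordChange 𝓘(ℝ, E) y x₀ y
      (-VectorField.mlieBracket 𝓘(ℝ, E) B (constField x₀ w) y) := by
    rw [mlieBracket_constField hBs hy, hyu]
    refine (tangentCoordChange_tangentCoordChange' hy _).symm.trans ?_
    exact congrArg (tangentCoordChange 𝓘(ℝ, E) y x₀ y) (neg_neg _).symm
  -- The derivative of B in the chart is minus its bracket with constant fields, and multiplying
  -- such a field by i amounts to applying J.
  have h2 : constField x₀ (Complex.I • v) =ᶠ[𝓝 y]
      fun z => complexStructure z (constField x₀ v z) := by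
    filter_upwards [(chartAt E x₀).open_source.mem_nhds hy] with z hz
    exact tangentCoordChange_I_smul hz (mem_chart_source E z) v
  rw [h1, h1, Filter.EventuallyEq.rfl.mlieBracket_vectorField_eq h2,
    mlieBracket_leeField_complexStructure hg hlck hnabla hlee hB (hBs y).isDiffAt
      (isSmoothAt_constField hy v).isDiffAt, ← map_neg]
  exact tangentCoordChange_complexStructure hy _

/-- The complex line spanned by a nonzero vector has real dimension `2`. -/
theorem finrank_span_neg_I_smul {b : E} (hb : b ≠ 0) :
    Module.finrank ℝ (Submodule.span ℝ {-(Complex.I • b), b}) = 2 :=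
  finrank_leePlane (M := E) (B := fun _ => b) (x := b) hb

theorem mem_span_pair_iff_of_injective {V W : Type*} [AddCommGroup V] [Module ℝ V]
    [TopologicalSpace V] [AddCommGroup W] [Module ℝ W] [TopologicalSpace W] {T : V →L[ℝ] W}
    (hT : Function.Injective T) (a b v : V) :
    v ∈ Submodule.span ℝ {a, b} ↔ T v ∈ Submodule.span ℝ {T a, T b} := by
  simp only [Submodule.mem_span_pair, ← map_smul, ← map_add, hT.eq_iff]

/-- A holomorphic chart that makes B the constant b also makes A = −JB the constant −ib, so
straightening one field straightens the whole plane. -/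
theorem isTangentToFoliationOn_leePlane [FiniteDimensional ℂ E] (hg : IsHermitianMetric g ν)
    (hlck : IsLocallyConformalKahler g lee)
    (hnabla : IsLeviCivitaOn g nabla Set.univ) (hlee : IsParallelForm nabla lee)
    (hB : IsLeeField g lee B) (hBs : ∀ x, IsSmoothAt B x) :
    IsTangentToFoliationOn (leePlane B) 2 (Sing B)ᶜ := by
  have : CompleteSpace E := FiniteDimensional.complete ℂ E
  intro x₀ hx₀
  let φ := chartAt E x₀
  let F := chartRep B x₀
  have hF : ContDiffOn ℂ ∞ F φ.target :=
    contDiffOn_complex φ.open_target (contDiffOn_chartRep x₀ hBs) fun u hu v =>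
      fderiv_chartRep_I_smul hg hlck hnabla hlee hB hBs x₀ hu v
  -- Restricting to the nonzero set of F keeps the final chart inside the complement of Sing(B).
  have hU : IsOpen (φ.target ∩ F ⁻¹' {0}ᶜ) :=
    hF.continuousOn.isOpen_inter_preimage φ.open_target isOpen_compl_singleton
  have hxs : x₀ ∈ φ.source := mem_chart_source E x₀
  have hF0 : F (φ x₀) ≠ 0 := by
    have h1 : F (φ x₀) = tangentCoordChange 𝓘(ℝ, E) x₀ x₀ x₀ (B x₀) := chartRep_chartAt B hxs
    rw [h1]
    exact fun h => hx₀ ((tangentCoordChange_self (I := 𝓘(ℝ, E)) (x := x₀) (z := x₀)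
      (v := show E from B x₀) (by simp)).symm.trans h)
  obtain ⟨e, hxe, heU, he, hes, hder⟩ := exists_straightening hU
    (hF.mono Set.inter_subset_left) ⟨φ.map_source hxs, hF0⟩ hF0
  let χ : OpenPartialHomeomorph M E := φ.trans e.symm
  have hχs : χ.source = φ.source ∩ φ ⁻¹' e.target := by simp [χ]
  have hχt : χ.target ⊆ e.source := by
    rw [OpenPartialHomeomorph.trans_target]; exact Set.inter_subset_left
  set b := F (φ x₀) with hb
  have hesR : ContDiffOn ℝ ∞ e.symm e.target := hes.restrict_scalars ℝ
  have heR : ContDiffOn ℝ ∞ e e.source := he.restrict_scalars ℝ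
  have hχ1 : ContMDiffOn 𝓘(ℝ, E) 𝓘(ℝ, E) ∞ χ χ.source :=
    hesR.contMDiffOn.comp (contMDiffOn_chart.mono (hχs ▸ Set.inter_subset_left))
      (hχs ▸ Set.inter_subset_right)
  have hχ2 : ContMDiffOn 𝓘(ℝ, E) 𝓘(ℝ, E) ∞ χ.symm χ.target := by
    refine (contMDiffOn_chart_symm (I := 𝓘(ℝ, E)) (x := x₀)).comp (heR.contMDiffOn.mono hχt) ?_
    intro w hw
    exact (heU (e.map_source (hχt hw))).1
  refine ⟨χ, χ.mem_maximalAtlas_of_contMDiffOn hχ1 hχ2, ?_, ?_,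
    Submodule.span ℝ {-(Complex.I • b), b}, finrank_span_neg_I_smul hF0, ?_⟩
  · rw [hχs]; exact ⟨hxs, hxe⟩
  · intro y hy hBy
    rw [hχs] at hy
    refine (heU hy.2).2 ?_
    change chartRep B x₀ (chartAt E x₀ y) = 0
    rw [chartRep_chartAt B hy.1, show B y = 0 from hBy]
    exact map_zero _
  · intro y hy v
    rw [hχs] at hy
    have hyt : φ y ∈ e.target := hy.2
    set w := e.symm (φ y) with hw
    have hws : w ∈ e.source := e.map_target hyt
    have hew : e w = φ y := e.right_inv hyt
    have hsymm : HasFDerivAt e.symm (fderiv ℂ e.symm (φ y)) (φ y) :=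
      ((hes.contDiffAt (e.open_target.mem_nhds hyt)).differentiableAt (by simp)).hasFDerivAt
    have hdir : HasFDerivAt e (fderiv ℂ e w) w :=
      ((he.contDiffAt (e.open_source.mem_nhds hws)).differentiableAt (by simp)).hasFDerivAt
    set D := fderiv ℂ e.symm (φ y) with hD
    have hDl (z : E) : D (fderiv ℂ e w z) = z := by
      have h1 : HasFDerivAt (e.symm ∘ e) (D.comp (fderiv ℂ e w)) w := by
        rw [← hew] at hsymm
        exact hsymm.comp w hdir
      have h2 : HasFDerivAt (e.symm ∘ e) (ContinuousLinearMap.id ℂ E) w :=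
        (hasFDerivAt_id w).congr_of_eventuallyEq (by
          filter_upwards [e.open_source.mem_nhds hws] with q hq
          exact e.left_inv hq)
      exact congrArg (fun T : E →L[ℂ] E => T z) (h1.unique h2)
    have hDr (z : E) : fderiv ℂ e w (D z) = z := by
      have h1 : HasFDerivAt (e ∘ e.symm) ((fderiv ℂ e w).comp D) (φ y) :=
        hdir.comp (φ y) hsymm
      have h2 : HasFDerivAt (e ∘ e.symm) (ContinuousLinearMap.id ℂ E) (φ y) :=
        (hasFDerivAt_id (φ y)).congr_of_eventuallyEq (by
          filter_upwards [e.open_target.mem_nhds hyt] with q hq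
          exact e.right_inv hq)
      exact congrArg (fun T : E →L[ℂ] E => T z) (h1.unique h2)
    have hmf (z : TangentSpace 𝓘(ℝ, E) y) : (mfderiv 𝓘(ℝ, E) 𝓘(ℝ, E) χ y z : E) =
        D (tangentCoordChange 𝓘(ℝ, E) y x₀ y z) := by
      have h1 : HasMFDerivAt 𝓘(ℝ, E) 𝓘(ℝ, E) φ y (tangentCoordChange 𝓘(ℝ, E) y x₀ y) := by
        rw [← mfderiv_chartAt_eq_tangentCoordChange hy.1]
        exact (mdifferentiableAt_atlas (ChartedSpace.chart_mem_atlas x₀) hy.1).hasMFDerivAt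
      have h2 := ((hsymm.restrictScalars ℝ).hasMFDerivAt).comp y h1
      have h3 : mfderiv 𝓘(ℝ, E) 𝓘(ℝ, E) χ y = _ := h2.mfderiv
      rw [h3]
      rfl
    -- The derivative of `e` sends b to F at each point, and D is its inverse.
    have hBy : D (tangentCoordChange 𝓘(ℝ, E) y x₀ y (B y)) = b := by
      rw [← chartRep_chartAt B hy.1, ← hDl b, hder w hws, hew]
    have hAy : D (tangentCoordChange 𝓘(ℝ, E) y x₀ y (antiLee B y)) = -(Complex.I • b) := by
      have h1 : tangentCoordChange 𝓘(ℝ, E) y x₀ y (antiLee B y) =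
          -(Complex.I • tangentCoordChange 𝓘(ℝ, E) y x₀ y (B y)) := by
        rw [← tangentCoordChange_complexStructure hy.1]
        exact map_neg _ _
      rw [h1, map_neg, map_smul, hBy]
    have hinj : Function.Injective
        ((D.restrictScalars ℝ).comp (tangentCoordChange 𝓘(ℝ, E) y x₀ y)) := by
      refine Function.LeftInverse.injective
        (g := fun z => tangentCoordChange 𝓘(ℝ, E) x₀ y y (fderiv ℂ e w z)) fun z => ?_
      exact (congrArg _ (hDr _)).trans (tangentCoordChange_tangentCoordChange hy.1 z)
    refine (mem_span_pair_iff_of_injective hinj (antiLee B y) (B y) v).trans ?_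
    refine Iff.of_eq (congrArg₂ (fun (W : Submodule ℝ E) z => z ∈ W) ?_ (hmf v).symm)
    exact congrArg₂ (fun a b : E => Submodule.span ℝ {a, b}) hAy hBy

end FoliatedChart

/-! ### Complements of totally null subspaces -/

section LinearAlgebra

variable {V : Type*} [AddCommGroup V] [Module ℝ V] [FiniteDimensional ℝ V]
  {b : LinearMap.BilinForm ℝ V}

/-- A totally null subspace `T` has the complement `l ⊔ S`, where `S` is a complement of `T` in
`Tᗮ` and `l` is a totally null complement of `T` in `Sᗮ`. -/
theorem isCompl_sup_of_isTotallyNull (hb : b.Nondegenerate) (hsymm : b.IsRefl)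
    {T S l : Submodule ℝ V} (hT : T ≤ b.orthogonal T)
    (hTS : Disjoint T S) (hTS' : T ⊔ S = b.orthogonal T) (hTl' : T ⊔ l = b.orthogonal S)
    (hl : ∀ v ∈ l, ∀ w ∈ l, b v w = 0) : IsCompl (l ⊔ S) T := by
  constructor
  · rw [Submodule.disjoint_def]
    intro x hx hxT
    obtain ⟨y, hy, s, hs, rfl⟩ := Submodule.mem_sup.1 hx
    have hsT : s ∈ b.orthogonal T := hTS' ▸ Submodule.mem_sup_right hs
    have hyT : y ∈ b.orthogonal T := by
      have := (b.orthogonal T).sub_mem (hT hxT) hsT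
      rwa [add_sub_cancel_right] at this
    -- The vector y is orthogonal to T and, l being null, to l; hence it is orthogonal to T + l =
    -- Sᗮ. So y lies in S, and y + s lies in S ∩ T = 0.
    have hyS : y ∈ b.orthogonal (b.orthogonal S) := by
      rw [← hTl']
      intro w hw
      obtain ⟨t, ht, z, hz, rfl⟩ := Submodule.mem_sup.1 hw
      have h1 : b t y = 0 := hyT t ht
      rw [map_add, _root_.LinearMap.add_apply, h1, hl z hz y hy, add_zero]
    rw [LinearMap.BilinForm.orthogonal_orthogonal hb hsymm] at hyS
    exact Submodule.disjoint_def.1 hTS _ hxT (S.add_mem hyS hs)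
  · rw [codisjoint_iff]
    -- The orthogonal of this sum lies in T ∩ S = 0, so by nondegeneracy the sum is everything.
    have h1 : l ⊔ S ⊔ T = b.orthogonal T ⊔ b.orthogonal S := by
      rw [← hTS', ← hTl', sup_comm (l ⊔ S) T, sup_comm l S, ← sup_assoc, sup_sup_sup_comm, sup_idem,
        sup_assoc]
    have h2 : b.orthogonal (b.orthogonal T ⊔ b.orthogonal S) ≤ ⊥ := by
      rw [← disjoint_iff.1 hTS]
      refine le_inf ?_ ?_
      · conv_rhs => rw [← LinearMap.BilinForm.orthogonal_orthogonal hb hsymm T]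
        exact LinearMap.BilinForm.orthogonal_le le_sup_left
      · conv_rhs => rw [← LinearMap.BilinForm.orthogonal_orthogonal hb hsymm S]
        exact LinearMap.BilinForm.orthogonal_le le_sup_right
    rw [h1, ← LinearMap.BilinForm.orthogonal_orthogonal hb hsymm (b.orthogonal T ⊔ _),
      le_bot_iff.1 h2, LinearMap.BilinForm.orthogonal_bot]

end LinearAlgebra

/-! ### The distribution P and the metric on it -/

section LeeFoliation

variable {E : Type*} [NormedAddCommGroup E] [NormedSpace ℂ E]
  {M : Type*} [TopologicalSpace M] [ChartedSpace E M] [IsManifold 𝓘(ℂ, E) ω M]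
  {g : Π x : M, TangentSpace 𝓘(ℝ, E) x →L[ℝ] TangentSpace 𝓘(ℝ, E) x →L[ℝ] ℝ} {ν : ℕ}
  {lee : Π x : M, TangentSpace 𝓘(ℝ, E) x →L[ℝ] ℝ}
  {nabla : (Π x : M, TangentSpace 𝓘(ℝ, E) x) →
      (Π x : M, TangentSpace 𝓘(ℝ, E) x →L[ℝ] TangentSpace 𝓘(ℝ, E) x)}
  {B : Π x : M, TangentSpace 𝓘(ℝ, E) x}

/-- A real function with vanishing derivative on a manifold is locally constant. -/
theorem isLocallyConstant_of_mvfderiv_eq_zero {f : M → ℝ}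
    (hf : ∀ x, MDifferentiableAt 𝓘(ℝ, E) 𝓘(ℝ, ℝ) f x)
    (hf' : ∀ x, mvfderiv 𝓘(ℝ, E) f x = 0) : IsLocallyConstant f := by
  rw [IsLocallyConstant.iff_eventually_eq]
  intro x
  set φ := chartAt E x
  have hx : x ∈ φ.source := mem_chart_source E x
  obtain ⟨r, hr, hball⟩ := Metric.isOpen_iff.1 φ.open_target (φ x) (φ.map_source hx)
  have hd : ∀ u ∈ Metric.ball (φ x) r, HasFDerivAt (f ∘ φ.symm) (0 : E →L[ℝ] ℝ) u := by
    intro u hu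
    have h1 : MDifferentiableAt 𝓘(ℝ, E) 𝓘(ℝ, E) φ.symm u :=
      mdifferentiableAt_atlas_symm (ChartedSpace.chart_mem_atlas x) (hball hu)
    have h2 := ((hf (φ.symm u)).hasMFDerivAt.comp u h1.hasMFDerivAt).hasFDerivAt
    refine h2.congr_fderiv ?_
    ext v
    exact (congrArg (fun T : TangentSpace 𝓘(ℝ, E) (φ.symm u) →L[ℝ] ℝ =>
      T (mfderiv 𝓘(ℝ, E) 𝓘(ℝ, E) φ.symm u v)) (hf' (φ.symm u)))
  have hconst : ∀ u ∈ Metric.ball (φ x) r, (f ∘ φ.symm) u = (f ∘ φ.symm) (φ x) := by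
    intro u hu
    refine (convex_ball (φ x) r).is_const_of_fderivWithin_eq_zero (𝕜 := ℝ)
      (fun w hw => (hd w hw).differentiableAt.differentiableWithinAt) (fun w hw => ?_) hu
      (Metric.mem_ball_self hr)
    rw [fderivWithin_of_isOpen Metric.isOpen_ball hw, (hd w hw).fderiv]
  filter_upwards [φ.open_source.mem_nhds hx,
    (φ.continuousAt hx).preimage_mem_nhds (Metric.ball_mem_nhds _ hr)] with y hy hyr
  have := hconst _ hyr
  simpa [φ.left_inv hy, φ.left_inv hx] using this

theorem isLocallyConstant_leeField_sq (hg : IsHermitianMetric g ν)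
    (hnabla : IsLeviCivitaOn g nabla Set.univ) (hlee : IsParallelForm nabla lee)
    (hB : IsLeeField g lee B) (hBs : ∀ x, IsSmoothAt B x) :
    IsLocallyConstant fun x => g x (B x) (B x) :=
  isLocallyConstant_of_mvfderiv_eq_zero
    (fun x => (hBs x).isDiffAt.metric hg (hBs x).isDiffAt)
    fun x => mvfderiv_leeField_sq_eq_zero hg hnabla hlee hB (hBs x).isDiffAt

theorem isOpen_compl_sing (hBs : ∀ x, IsSmoothAt B x) : IsOpen (Sing B)ᶜ := by
  rw [isOpen_iff_mem_nhds]
  intro x hx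
  have hxs := mem_chart_source E x
  have h1 := ((isSmoothAt_iff hxs).1 (hBs x)).continuousAt
  have h2 : tangentCoordChange 𝓘(ℝ, E) x x x (B x) ≠ 0 := fun h =>
    hx ((tangentCoordChange_self (I := 𝓘(ℝ, E)) (x := x) (z := x)
      (v := show E from B x) (by simp)).symm.trans h)
  filter_upwards [h1.eventually_ne h2] with y hy hBy
  refine hy ?_
  rw [show B y = 0 from hBy]
  exact map_zero _

theorem isSmoothDistributionOn_leePlane (hBs : ∀ x, IsSmoothAt B x) :
    IsSmoothDistributionOn (leePlane B) 2 (Sing B)ᶜ := by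
  intro x hx
  refine ⟨(Sing B)ᶜ, (isOpen_compl_sing hBs).mem_nhds hx, ![antiLee B, B], ?_, ?_⟩
  · intro j
    fin_cases j
    · exact fun y _ => (hBs y).antiLee.contMDiffWithinAt
    · exact fun y _ => (hBs y).contMDiffWithinAt
  · intro y hy
    have h1 : (fun j => (![antiLee B, B] : Fin 2 → Π z : M, TangentSpace 𝓘(ℝ, E) z) j y) =
        ![antiLee B y, B y] := by
      ext j; fin_cases j <;> rfl
    rw [h1, range_vecCons_pair]
    exact ⟨linearIndependent_antiLee hy, rfl⟩

/-- The bracket is ∇_X Y − ∇_Y X, and both terms lie in P by parallelism of P along the identity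
map. -/
theorem isInvolutiveOn_leePlane (hg : IsHermitianMetric g ν)
    (hlck : IsLocallyConformalKahler g lee)
    (hnabla : IsLeviCivitaOn g nabla Set.univ) (hlee : IsParallelForm nabla lee)
    (hB : IsLeeField g lee B) (hBs : ∀ x, IsSmoothAt B x) :
    IsInvolutiveOn (leePlane B) (Sing B)ᶜ := by
  intro V hV hVS X Y hX hY hXY y hy
  have hVy := hV.mem_nhds hy
  have hXd : IsDiffAt X y := IsSmoothAt.isDiffAt (hX.contMDiffAt hVy)
  have hYd : IsDiffAt Y y := IsSmoothAt.isDiffAt (hY.contMDiffAt hVy)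
  have key {Z W : Π x : M, TangentSpace 𝓘(ℝ, E) x} (hZ : IsDiffAt Z y)
      (hZP : ∀ z ∈ V, Z z ∈ leePlane B z) (hW : W y ∈ leePlane B y) :
      nabla Z y (W y) ∈ leePlane B y := by
    have h1 := nabla_mem_leePlane hg hlck hnabla hlee hB (I := 𝓘(ℝ, E)) (j := (id : M → M))
      (p := y) (v := W y) mdifferentiableAt_id (by rw [mfderiv_id]; exact hW) (hBs y) (hVS hy) hZ
      (Filter.mem_of_superset hVy hZP)
    rw [mfderiv_id] at h1
    exact h1
  rw [← hnabla.torsionFree y trivial X Y hXd hYd]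
  exact Submodule.sub_mem _ (key hYd (fun z hz => (hXY z hz).2) (hXY y hy).1)
    (key hXd (fun z hz => (hXY z hz).1) (hXY y hy).2)

omit [IsManifold 𝓘(ℂ, E) ω M] in
theorem mem_perp {x : M} {W : Submodule ℝ (TangentSpace 𝓘(ℝ, E) x)}
    {v : TangentSpace 𝓘(ℝ, E) x} : v ∈ perp g x W ↔ ∀ w ∈ W, g x w v = 0 := Iff.rfl

theorem IsHermitianMetric.isRefl_form (hg : IsHermitianMetric g ν) (x : M) : (form g x).IsRefl :=
  fun v w h => (hg.symm x w v).trans h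

theorem IsHermitianMetric.nondegenerate_form (hg : IsHermitianMetric g ν) (x : M) :
    (form g x).Nondegenerate :=
  ⟨fun v h => hg.nondegenerate x v h,
    fun v h => hg.nondegenerate x v fun w => (hg.symm x v w).trans (h w)⟩

/-- The metric on the Lee plane is `g(B, B)` times the Euclidean one. -/
theorem metric_leePlane (hg : IsHermitianMetric g ν) (x : M) (k l k' l' : ℝ) :
    g x (k • antiLee B x + l • B x) (k' • antiLee B x + l' • B x) =
      (k * k' + l * l') * g x (B x) (B x) := by
  have h1 : g x (antiLee B x) (antiLee B x) = g x (B x) (B x) := by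
    simp [antiLee, hg.hermitian]
  have h2 : g x (B x) (antiLee B x) = 0 := by
    rw [hg.symm]
    simpa [antiLee] using hg.complexStructure_self x (B x)
  have h3 : g x (antiLee B x) (B x) = 0 := by rw [hg.symm, h2]
  simp only [map_add, map_smul, _root_.add_apply, _root_.smul_apply, smul_eq_mul, h1, h2, h3]
  ring

theorem leePlane_le_perp (hg : IsHermitianMetric g ν) {x : M} (h0 : g x (B x) (B x) = 0) :
    leePlane B x ≤ perp g x (leePlane B x) := by
  intro v hv w hw
  obtain ⟨k, l, rfl⟩ := Submodule.mem_span_pair.1 hv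
  obtain ⟨k', l', rfl⟩ := Submodule.mem_span_pair.1 hw
  exact (metric_leePlane hg x k' l' k l).trans (by rw [h0, mul_zero])

theorem metric_pos_of_mem_leePlane (hg : IsHermitianMetric g ν) {x : M} {c : ℝ} (hc : c ≠ 0)
    (h0 : g x (B x) (B x) = c) {v : TangentSpace 𝓘(ℝ, E) x} (hv : v ∈ leePlane B x) (hv0 : v ≠ 0) :
    0 < Real.sign c * g x v v := by
  obtain ⟨k, l, rfl⟩ := Submodule.mem_span_pair.1 hv
  rw [metric_leePlane hg, h0]
  have h1 : 0 < k * k + l * l := by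
    by_contra! h
    have hk : k = 0 := by nlinarith [mul_self_nonneg k, mul_self_nonneg l]
    have hl : l = 0 := by nlinarith [mul_self_nonneg k, mul_self_nonneg l]
    exact hv0 (by rw [hk, hl]; module)
  have h2 : 0 < Real.sign c * c := by
    rcases hc.lt_or_gt with h | h
    · rw [Real.sign_of_neg h]; linarith
    · rw [Real.sign_of_pos h]; linarith
  nlinarith [mul_pos h1 h2]

/-- For c ≠ 0 the metric is definite on P, so no nonzero vector of P is orthogonal to itself. -/
theorem disjoint_leePlane_perp (hg : IsHermitianMetric g ν) {x : M} {c : ℝ} (hc : c ≠ 0)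
    (h0 : g x (B x) (B x) = c) : Disjoint (leePlane B x) (perp g x (leePlane B x)) := by
  rw [Submodule.disjoint_def]
  intro v hv hv'
  by_contra hv0
  have h1 := metric_pos_of_mem_leePlane hg hc h0 hv hv0
  rw [mem_perp.1 hv' v hv, mul_zero] at h1
  exact lt_irrefl _ h1

/-! ### Geometry of the integral surfaces -/

section Surface

variable {L : Type*} [TopologicalSpace L] [ChartedSpace (EuclideanSpace ℝ (Fin 2)) L] {i : L → M}
  {U : Set M}

theorem IsIntegralSurface.mfderiv_mem {P : Π x : M, Submodule ℝ (TangentSpace 𝓘(ℝ, E) x)}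
    (hi : IsIntegralSurface P U i) (p : L) (v : TangentSpace 𝓘(ℝ, EuclideanSpace ℝ (Fin 2)) p) :
    mfderiv 𝓘(ℝ, EuclideanSpace ℝ (Fin 2)) 𝓘(ℝ, E) i p v ∈ P (i p) := by
  rw [← hi.tangent]
  exact ⟨v, rfl⟩

theorem IsIntegralSurface.isRiemannianUpTo (hg : IsHermitianMetric g ν)
    (hi : IsIntegralSurface (leePlane B) U i) {c : ℝ} (hc : c ≠ 0)
    (h0 : ∀ x, g x (B x) (B x) = c) : IsRiemannianUpTo g i (Real.sign c) := by
  intro p v hv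
  refine metric_pos_of_mem_leePlane hg hc (h0 _) (hi.mfderiv_mem p v) fun h => hv ?_
  exact hi.immersion p (h.trans (map_zero _).symm)

/-- The second fundamental form of an integral surface of the Lee plane vanishes with respect to
each complement of its tangent bundle. -/
theorem IsIntegralSurface.secondFundamentalFormVanishes (hg : IsHermitianMetric g ν)
    (hlck : IsLocallyConformalKahler g lee)
    (hnabla : IsLeviCivitaOn g nabla Set.univ) (hlee : IsParallelForm nabla lee)
    (hB : IsLeeField g lee B) (hBs : ∀ x, IsSmoothAt B x)
    (hi : IsIntegralSurface (leePlane B) (Sing B)ᶜ i)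
    {tr : Π p : L, Submodule ℝ (TangentSpace 𝓘(ℝ, E) (i p))}
    (htr : ∀ p, IsCompl (tr p) (tangentPlane i p)) : SecondFundamentalFormVanishes nabla i tr := by
  refine fun p => ⟨htr p, fun v Y hY hYP => ?_⟩
  rw [Submodule.projection_apply_eq_zero_iff, hi.tangent]
  refine nabla_mem_leePlane hg hlck hnabla hlee hB (hi.contMDiff.mdifferentiable (by simp) p)
    (hi.mfderiv_mem p v) (hBs _) (hi.mem p) (IsSmoothAt.isDiffAt hY) ?_
  filter_upwards [hYP] with q hq
  rwa [← hi.tangent]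

/-- The acceleration of a curve in L lies in P, because the curve is tangent to P. If it is also
normal it vanishes, as P meets its orthogonal trivially for c ≠ 0. -/
theorem IsIntegralSurface.isTotallyGeodesic (hg : IsHermitianMetric g ν)
    (hlck : IsLocallyConformalKahler g lee)
    (hnabla : IsLeviCivitaOn g nabla Set.univ) (hlee : IsParallelForm nabla lee)
    (hB : IsLeeField g lee B) (hBs : ∀ x, IsSmoothAt B x)
    (hi : IsIntegralSurface (leePlane B) (Sing B)ᶜ i) {c : ℝ} (hc : c ≠ 0)
    (h0 : ∀ x, g x (B x) (B x) = c) : IsTotallyGeodesic g nabla i := by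
  intro T γ hT hγ hacc t ht
  obtain ⟨a, ha, V, hV, hVγ, hVa⟩ := hacc t ht
  have hγd : ∀ s ∈ T, MDifferentiableAt 𝓘(ℝ, ℝ) 𝓘(ℝ, EuclideanSpace ℝ (Fin 2)) γ s := fun s hs =>
    (hγ.contMDiffAt (hT.mem_nhds hs)).mdifferentiableAt (by simp)
  have hid (p : L) : MDifferentiableAt 𝓘(ℝ, EuclideanSpace ℝ (Fin 2)) 𝓘(ℝ, E) i p :=
    hi.contMDiff.mdifferentiable (by simp) p
  have hvel : ∀ s ∈ T, velocity (fun s => i (γ s)) s ∈ leePlane B (i (γ s)) := by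
    intro s hs
    have h1 := mfderiv_comp_apply s (hid (γ s)) (hγd s hs) (1 : ℝ)
    have h2 : velocity (fun s => i (γ s)) s = _ := h1
    rw [h2]
    exact hi.mfderiv_mem _ _
  have h1 : nabla V (i (γ t)) (velocity (fun s => i (γ s)) t) ∈ leePlane B (i (γ t)) := by
    refine nabla_mem_leePlane hg hlck hnabla hlee hB (j := fun s => i (γ s))
      ((hid (γ t)).comp t (hγd t ht)) (hvel t ht) (hBs _) (hi.mem _) (IsSmoothAt.isDiffAt hV) ?_
    filter_upwards [hVγ, hT.mem_nhds ht] with s hs hsT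
    rw [hs]
    exact hvel s hsT
  refine ⟨V, hV, hVγ, ?_⟩
  rw [hVa] at h1 ⊢
  rw [normalBundle, hi.tangent] at ha
  exact Submodule.disjoint_def.1 (disjoint_leePlane_perp hg hc (h0 _)) a h1 ha

variable [FiniteDimensional ℂ E]

theorem isCompl_normalBundle (hg : IsHermitianMetric g ν)
    (hi : IsIntegralSurface (leePlane B) U i) {c : ℝ} (hc : c ≠ 0)
    (h0 : ∀ x, g x (B x) (B x) = c) (p : L) : IsCompl (normalBundle g i p) (tangentPlane i p) := by
  have : FiniteDimensional ℝ (TangentSpace 𝓘(ℝ, E) (i p)) := FiniteDimensional.complexToReal E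
  rw [normalBundle, hi.tangent]
  exact ((LinearMap.BilinForm.isCompl_orthogonal_iff_disjoint (hg.isRefl_form (i p))).2
    (disjoint_leePlane_perp hg hc (h0 (i p)))).symm

omit [FiniteDimensional ℂ E] in
theorem radical_eq_tangentPlane (hg : IsHermitianMetric g ν)
    (hi : IsIntegralSurface (leePlane B) U i) (h0 : ∀ x, g x (B x) (B x) = 0) (p : L) :
    radical g i p = tangentPlane i p := by
  rw [radical, normalBundle, hi.tangent]
  exact inf_eq_left.2 (leePlane_le_perp hg (h0 _))

omit [FiniteDimensional ℂ E] in
theorem finrank_tangentPlane (hi : IsIntegralSurface (leePlane B) (Sing B)ᶜ i) (p : L) :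
    Module.finrank ℝ (tangentPlane (E := E) i p) = 2 := by
  rw [hi.tangent]
  exact finrank_leePlane (hi.mem p)

/-- The real codimension is 2n − 2; comparison with the dimension 2 separates the isotropic case n ≥
3 from the totally lightlike case n = 2. -/
theorem finrank_quotient_tangentPlane (hi : IsIntegralSurface (leePlane B) (Sing B)ᶜ i) (p : L) :
    Module.finrank ℝ (TangentSpace 𝓘(ℝ, E) (i p) ⧸ tangentPlane i p) + 2 =
      2 * Module.finrank ℂ E := by
  have : FiniteDimensional ℝ (TangentSpace 𝓘(ℝ, E) (i p)) := FiniteDimensional.complexToReal E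
  have h1 := Submodule.finrank_quotient_add_finrank (tangentPlane (E := E) i p)
  rw [finrank_tangentPlane hi p] at h1
  exact h1.trans (finrank_real_of_complex E)

/-- For c = 0 the tangent plane is totally null, and the claim is linear algebra in each fibre. -/
theorem IsTransversalBundle.isCompl (hg : IsHermitianMetric g ν)
    (hi : IsIntegralSurface (leePlane B) U i) (h0 : ∀ x, g x (B x) (B x) = 0) {n : ℕ}
    {tr : Π p : L, Submodule ℝ (TangentSpace 𝓘(ℝ, E) (i p))} (htr : IsTransversalBundle g n i tr)
    (p : L) : IsCompl (tr p) (tangentPlane i p) := by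
  have : FiniteDimensional ℝ (TangentSpace 𝓘(ℝ, E) (i p)) := FiniteDimensional.complexToReal E
  obtain ⟨S, l, -, -, h⟩ := htr
  obtain ⟨h1, h2, -, h4, h5, h6⟩ := h p
  rw [h6]
  refine isCompl_sup_of_isTotallyNull (hg.nondegenerate_form (i p)) (hg.isRefl_form (i p)) ?_
    h1 h2 h4 h5
  rw [hi.tangent]
  exact leePlane_le_perp hg (h0 _)

end Surface

end LeeFoliation

end LCK

end

open LCK

theorem theorem4 {E : Type*} [NormedAddCommGroup E] [NormedSpace ℂ E]
    [FiniteDimensional ℂ E]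
    {M : Type*} [TopologicalSpace M] [T2Space M] [ChartedSpace E M] [IsManifold 𝓘(ℂ, E) ω M]
    (n : ℕ) (hdim : Module.finrank ℂ E = n) (hn : 1 < n)
    (ν : ℕ) (hν : 0 < ν) (hν' : ν < 2 * n)
    (g : Π x : M, TangentSpace 𝓘(ℝ, E) x →L[ℝ] TangentSpace 𝓘(ℝ, E) x →L[ℝ] ℝ)
    (hg : IsHermitianMetric g ν)
    (lee : Π x : M, TangentSpace 𝓘(ℝ, E) x →L[ℝ] ℝ)
    (hlck : IsLocallyConformalKahler g lee)
    (nabla : (Π x : M, TangentSpace 𝓘(ℝ, E) x) →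
      (Π x : M, TangentSpace 𝓘(ℝ, E) x →L[ℝ] TangentSpace 𝓘(ℝ, E) x))
    (hnabla : IsLeviCivitaOn g nabla Set.univ)
    (hlee : IsParallelForm nabla lee)
    (B : Π x : M, TangentSpace 𝓘(ℝ, E) x) (hB : IsLeeField g lee B) :
    IsLocallyConstant (fun x => g x (B x) (B x)) ∧
    ∀ c : ℝ, (∀ x, g x (B x) (B x) = c) →
      IsOpen (Sing B)ᶜ ∧
      (∀ x ∈ (Sing B)ᶜ, LinearIndependent ℝ ![antiLee B x, B x]) ∧
      IsSmoothDistributionOn (leePlane B) 2 (Sing B)ᶜ ∧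
      IsInvolutiveOn (leePlane B) (Sing B)ᶜ ∧
      IsTangentToFoliationOn (leePlane B) 2 (Sing B)ᶜ ∧
      (c ≠ 0 → Sing B = ∅) ∧
      ∀ (L : Type*) [TopologicalSpace L] [ChartedSpace (EuclideanSpace ℝ (Fin 2)) L]
        [IsManifold 𝓘(ℝ, EuclideanSpace ℝ (Fin 2)) ∞ L] (i : L → M),
        IsIntegralSurface (leePlane B) (Sing B)ᶜ i →
        (c ≠ 0 →
          IsRiemannianUpTo g i (Real.sign c) ∧
          SecondFundamentalFormVanishes nabla i (normalBundle g i) ∧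
          IsTotallyGeodesic g nabla i) ∧
        (c = 0 →
          (3 ≤ n → IsIsotropic g i) ∧
          (n = 2 → IsTotallyLightlike g i) ∧
          (3 ≤ n → ∀ tr : Π p : L, Submodule ℝ (TangentSpace 𝓘(ℝ, E) (i p)),
            IsTransversalBundle g n i tr → SecondFundamentalFormVanishes nabla i tr)) := by
  have hBs : ∀ x, IsSmoothAt B x := hB.isSmoothAt hg hlck
  refine ⟨isLocallyConstant_leeField_sq hg hnabla hlee hB hBs, fun c hc => ⟨isOpen_compl_sing hBs,
    fun x hx => linearIndependent_antiLee hx, isSmoothDistributionOn_leePlane hBs,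
    isInvolutiveOn_leePlane hg hlck hnabla hlee hB hBs,
    isTangentToFoliationOn_leePlane hg hlck hnabla hlee hB hBs, fun hc0 => ?_,
    fun L _ _ _ i hi => ⟨fun hc0 => ⟨hi.isRiemannianUpTo hg hc0 hc, ?_, ?_⟩, ?_⟩⟩⟩
  · rw [Set.eq_empty_iff_forall_notMem]
    intro x hx
    refine hc0 ?_
    rw [← hc x, show B x = 0 from hx, map_zero]
  · exact hi.secondFundamentalFormVanishes hg hlck hnabla hlee hB hBs
      (isCompl_normalBundle hg hi hc0 hc)
  · exact hi.isTotallyGeodesic hg hlck hnabla hlee hB hBs hc0 hc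
  · rintro rfl
    refine ⟨fun hn3 p => ?_, fun hn2 p => ?_, fun _ tr htr => ?_⟩
    · have h1 := finrank_quotient_tangentPlane hi p
      rw [radical_eq_tangentPlane hg hi hc, finrank_tangentPlane hi]
      omega
    · have h1 := finrank_quotient_tangentPlane hi p
      rw [radical_eq_tangentPlane hg hi hc, finrank_tangentPlane hi]
      omega
    · exact hi.secondFundamentalFormVanishes hg hlck hnabla hlee hB hBs
        (htr.isCompl hg hi hc)
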